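/- **Setting.** Let $d\in\{1,2,3\}$, $p\in\mathbb N$ and $T>0$. Let $\Omega_0\subset\mathbb R^d$ be a bounded convex domain with polygonal boundary, and for $t\in[0,T]$ let $G(t)\subset\Omega_0$ be a bounded domain with polygonal boundary that equals the interior of its closure. Put $\Omega_1(t)=\Omega_0\setminus(G(t)\cup\partial G(t))$, $\Omega_2(t)=\Omega_0\cap G(t)$ and $\Gamma(t)=\partial\Omega_1(t)\cap\partial\Omega_2(t)$. Let $\mathcal T_0$ and $\mathcal T_G=\mathcal T_G(t)$ be finite conforming meshes of closed simplices of $\Omega_0$ and $G(t)$, let $h_K$ be the diameter of a simplex $K$, and let $0=t_0<\dots<t_N=T$, $k_n=t_n-t_{n-1}$. Both $G(t)$ and $\mathcal T_G(t)$ are constant on each interval $(t_{n-1},t_n]$. The meshes are quasi-uniform with a constant $\sigma$: in each of the meshes $\mathcal T_0$ and $\mathcal T_G(t)$, every simplex contains a ball of some radius $r>0$ with $\max_{K'} h_{K'}\le\sigma r$, where $K'$ runs over the simplices of that mesh. Moreover, with a constant $\kappa$, one has $h_K\le\kappa k_n$ and $k_n\le\kappa h_K$ for all $n$, all $t\in[0,T]$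 and all $K\in\mathcal T_0\cup\mathcal T_G(t)$. Let $V_{h,0}$ be the space of continuous piecewise polynomials of degree $\le p$ on $\mathcal T_0$ that vanish on $\partial\Omega_0$, let $V_{h,G}$ be the space of continuous piecewise polynomials of degree $\le p$ on $\mathcal T_G(t)$, and let $V_h(t)$ consist of the functions $v$ with $v|_{\Omega_1(t)}=v_0|_{\Omega_1(t)}$ and $v|_{\Omega_2(t)}=v_G|_{\Omega_2(t)}$ for some $v_0\in V_{h,0}$, $v_G\in V_{h,G}$. Let $\mathcal T_{0,\Gamma(t)}=\{K\in\mathcal T_0: K\cap\Gamma(t)\ne\emptyset\}$ and $\Omega_O(t)=\bigcup_{K\in\mathcal T_{0,\Gamma(t)}}K\cap\Omega_2(t)$. For $v\in V_h(t)$ with components $v_0,v_G$ write $[\nabla v]=\nabla v_0-\nabla v_G$ on $\Omega_O(t)$. With $n_i$ the outward unit normal of $\Omega_i(t)$ and $n=n_1$, let $w_i(s)=\lim_{\varepsilon\to0+}w(s-\varepsilon n_i)$ for $s\in\Gamma(t)$, $[v]=v_1-v_2$, and $\langle\partial_nv\rangle=\omega_1\,n\cdot(\nabla v)_1+\omega_2\,n\cdot(\nabla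 v)_2$, where $\omega_1,\omega_2\in[0,1]$, $\omega_1+\omega_2=1$. Let $h_K(x)=h_{K_0}$ for $x\in K_0\in\mathcal T_0$ (the largest such value if $x$ lies in several simplices). For a stabilization parameter $\gamma$ define $$A_{h,t}(w,v)=\sum_{i=1}^2(\nabla w,\nabla v)_{\Omega_i(t)}-(\langle\partial_nw\rangle,[v])_{\Gamma(t)}-(\langle\partial_nv\rangle,[w])_{\Gamma(t)}+(\gamma h_K^{-1}[w],[v])_{\Gamma(t)}+([\nabla w],[\nabla v])_{\Omega_O(t)},$$ $$|||v|||^2=\sum_{i=1}^2\|\nabla v\|^2_{\Omega_i(t)}+\sum_{K\in\mathcal T_{0,\Gamma(t)}}h_K\|\langle\partial_nv\rangle\|^2_{K\cap\Gamma(t)}+\sum_{K\in\mathcal T_{0,\Gamma(t)}}h_K^{-1}\|[v]\|^2_{K\cap\Gamma(t)}+\|[\nabla v]\|^2_{\Omega_O(t)},$$ where the inner products and norms are those of $L^2$ with respect to Lebesgue measure on $\Omega_i(t)$, $\Omega_O(t)$ and $(d-1)$-dimensional surface measure on $\Gamma(t)$ (counting measure if $d=1$). **Lemma (discrete coercivity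 of $A_{h,t}$).** There are constants $\gamma_0$ and $c>0$, depending only on $d$, $p$, $\sigma$ and $\kappa$, such that for all domains, time partitions, meshes and weights as above, all $\gamma\ge\gamma_0$ and all $t\in[0,T]$, $$A_{h,t}(v,v)\ \ge\ c\,|||v|||^2\qquad\text{for all } v\in V_h(t)$$ (and all choices of its components $v_0$, $v_G$). -/

import Mathlib

open Set Filter Topology MeasureTheory

noncomputable section

namespace CutFEM

/-- Euclidean space `ℝ^d`. -/
abbrev E (d : ℕ) : Type := EuclideanSpace ℝ (Fin d)

/-- A bounded domain with polygonal (polyhedral) boundary: a connected open set which is the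
interior of its closure (no slits), and whose closure is a finite union of convex polytopes. -/
structure IsPolygonalDomain {d : ℕ} (Ω : Set (E d)) : Prop where
  isOpen : IsOpen Ω
  isConnected : IsConnected Ω
  isBounded : Bornology.IsBounded Ω
  interior_closure : interior (closure Ω) = Ω
  polygonal : ∃ P : Finset (Finset (E d)), closure Ω = ⋃ s ∈ P, convexHull ℝ (s : Set (E d))

/-- The closed simplex with vertex set `s`. -/
def hull {d : ℕ} (s : Finset (E d)) : Set (E d) := convexHull ℝ (s : Set (E d))

/-- The diameter `h_K` of the simplex `K` with vertex set `s`. -/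
def hK {d : ℕ} (s : Finset (E d)) : ℝ := Metric.diam (hull s)

/-- The (vertex sets of the) full-dimensional simplices of a simplicial complex. -/
def cells {d : ℕ} (T : Geometry.SimplicialComplex ℝ (E d)) : Set (Finset (E d)) :=
  {s | s ∈ T.faces ∧ s.card = d + 1}

/-- `T` is a (finite, conforming) simplicial mesh of `Ω`. -/
def IsMeshOf {d : ℕ} (T : Geometry.SimplicialComplex ℝ (E d)) (Ω : Set (E d)) : Prop :=
  (cells T).Finite ∧ (⋃ s ∈ cells T, hull s) = closure Ω

/-- Quasi-uniformity with constant `σ`: every simplex contains a ball whose radius `r` satisfies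
`max_{K'} h_{K'} ≤ σ r`. -/
def IsQuasiUniform {d : ℕ} (σ : ℝ) (T : Geometry.SimplicialComplex ℝ (E d)) : Prop :=
  ∀ s ∈ cells T, ∃ (x : E d) (r : ℝ), 0 < r ∧ Metric.closedBall x r ⊆ hull s ∧
    ∀ s' ∈ cells T, hK s' ≤ σ * r

/-- A background mesh `T0` of `Ω0` and an overlapping mesh `TG t` of `G t ⊆ Ω0`, the latter evolving
in time in a simple discontinuous way on the time partition `0 = tn 0 < ... < tn N = T`.
The number `σ` is the quasi-uniformity constant of the meshes, `κ` is the constant in the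
space-time quasi-uniformity `h ≤ κ k_min`, `k ≤ κ h_min`. -/
structure OverlappingMeshes (d : ℕ) (σ κ : ℝ) where
  Ω0 : Set (E d)
  polygonal_Ω0 : IsPolygonalDomain Ω0
  convex_Ω0 : Convex ℝ Ω0
  T : ℝ
  T_pos : 0 < T
  N : ℕ
  tn : ℕ → ℝ
  tn_zero : tn 0 = 0
  tn_last : tn N = T
  tn_lt : ∀ n < N, tn n < tn (n + 1)
  G : ℝ → Set (E d)
  polygonal_G : ∀ t ∈ Icc 0 T, IsPolygonalDomain (G t)
  G_subset : ∀ t ∈ Icc 0 T, G t ⊆ Ω0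
  T0 : Geometry.SimplicialComplex ℝ (E d)
  TG : ℝ → Geometry.SimplicialComplex ℝ (E d)
  mesh_T0 : IsMeshOf T0 Ω0
  mesh_TG : ∀ t ∈ Icc 0 T, IsMeshOf (TG t) (G t)
  slabwise_const : ∀ n < N, ∀ t ∈ Ioc (tn n) (tn (n + 1)),
    G t = G (tn (n + 1)) ∧ TG t = TG (tn (n + 1))
  quasiUniform_T0 : IsQuasiUniform σ T0
  quasiUniform_TG : ∀ t ∈ Icc 0 T, IsQuasiUniform σ (TG t)
  quasiUniform_spaceTime : ∀ n < N, ∀ t ∈ Icc 0 T, ∀ s ∈ cells T0 ∪ cells (TG t),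
    hK s ≤ κ * (tn (n + 1) - tn n) ∧ tn (n + 1) - tn n ≤ κ * hK s

/-- `n` is the outward unit normal vector to the open set `Ω` at the boundary point `s`, which lies
in the flat part of the boundary: near `s`, `Ω` is the open half-space `{x | ⟪x - s, n⟫ < 0}`. -/
def IsOuterNormal {d : ℕ} (Ω : Set (E d)) (s n : E d) : Prop :=
  ‖n‖ = 1 ∧ ∀ᶠ x in 𝓝 s, x ∈ Ω ↔ inner ℝ (x - s) n < 0

open Classical in
/-- The outward unit normal of `Ω` at `s`; it exists at almost every boundary point of a polygonal
domain and is set to `0` (on a null set) where it does not exist. -/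
def outerNormal {d : ℕ} (Ω : Set (E d)) (s : E d) : E d :=
  if h : ∃ n, IsOuterNormal Ω s n then h.choose else 0

/-- The one-sided limit `lim_{ε → 0+} f (s - ε n)`. -/
def sideLimit {d : ℕ} {F : Type*} [TopologicalSpace F] [Nonempty F] (f : E d → F) (s n : E d) : F :=
  limUnder (𝓝[>] (0 : ℝ)) fun ε => f (s - ε • n)

/-- `v` is on every simplex of `T` a polynomial of degree at most `p`. -/
def IsPiecewisePoly {d : ℕ} (p : ℕ) (T : Geometry.SimplicialComplex ℝ (E d)) (v : E d → ℝ) : Prop :=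
  ∀ s ∈ cells T, ∃ q : MvPolynomial (Fin d) ℝ, q.totalDegree ≤ p ∧
    ∀ x ∈ hull s, v x = MvPolynomial.eval (fun i => x i) q

/-- A broken function: a function `val` on `Ω0` together with the functions `ext1` and `ext2` whose
restrictions to `Ω1(t)` and `Ω2(t)` it consists of. The latter are needed for the jump
`[∇v] = (∇v)_1 - (∇v)_2` on the overlap region, which lies in `Ω2(t)`: there `(∇v)_1` is the
gradient of the discrete function on the covered part of the background mesh. -/
structure BrokenFn (d : ℕ) where
  val : E d → ℝ
  ext1 : E d → ℝ
  ext2 : E d → ℝ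

namespace OverlappingMeshes

variable {d : ℕ} {σ κ : ℝ} (M : OverlappingMeshes d σ κ)

/-- `Ω1(t) = Ω0 \ (G ∪ ∂G)`. -/
def Ω1 (t : ℝ) : Set (E d) := M.Ω0 \ (M.G t ∪ frontier (M.G t))

/-- `Ω2(t) = Ω0 ∩ G`. -/
def Ω2 (t : ℝ) : Set (E d) := M.Ω0 ∩ M.G t

/-- `Γ(t) = ∂Ω1(t) ∩ ∂Ω2(t)`. -/
def Γ (t : ℝ) : Set (E d) := frontier (M.Ω1 t) ∩ frontier (M.Ω2 t)

/-- The simplices of the background mesh that are cut by `Γ(t)`. -/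
def cutCells (t : ℝ) : Set (Finset (E d)) := {s ∈ cells M.T0 | (hull s ∩ M.Γ t).Nonempty}

/-- The overlap region `Ω_O(t)`. -/
def ΩO (t : ℝ) : Set (E d) := ⋃ s ∈ M.cutCells t, hull s ∩ M.Ω2 t

/-- The mesh size function `h_K(x) = h_{K_0}` for `x ∈ K_0 ∈ T0`; where several closed simplices
meet, the largest of their diameters is taken. -/
def meshSize (x : E d) : ℝ := sSup (hK '' {s ∈ cells M.T0 | x ∈ hull s})

/-- `V_{h,0}`: continuous piecewise polynomials of degree at most `p` on `T0`, zero on `∂Ω0`. -/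
def Vh0 (p : ℕ) : Set (E d → ℝ) :=
  {v | ContinuousOn v (closure M.Ω0) ∧ IsPiecewisePoly p M.T0 v ∧ ∀ x ∈ frontier M.Ω0, v x = 0}

/-- `V_{h,G}`: continuous piecewise polynomials of degree at most `p` on `TG` (at time `t`). -/
def VhG (p : ℕ) (t : ℝ) : Set (E d → ℝ) :=
  {v | ContinuousOn v (closure (M.G t)) ∧ IsPiecewisePoly p (M.TG t) v}

/-- The broken finite element space `V_h(t)`. -/
def Vh (p : ℕ) (t : ℝ) : Set (BrokenFn d) :=
  {v | v.ext1 ∈ M.Vh0 p ∧ v.ext2 ∈ M.VhG p t ∧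
    EqOn v.val v.ext1 (M.Ω1 t) ∧ EqOn v.val v.ext2 (M.Ω2 t)}

/-- The outward unit normal `n_1` of `Ω1(t)`. -/
def n1 (t : ℝ) (s : E d) : E d := outerNormal (M.Ω1 t) s

/-- The outward unit normal `n_2` of `Ω2(t)`. -/
def n2 (t : ℝ) (s : E d) : E d := outerNormal (M.Ω2 t) s

/-- The jump `[v] = v_1 - v_2` over `Γ(t)`. -/
def jump (t : ℝ) (v : BrokenFn d) (s : E d) : ℝ :=
  sideLimit v.val s (M.n1 t s) - sideLimit v.val s (M.n2 t s)

/-- The weighted average `⟨∂_n v⟩ = ω₁ (∂_n v)_1 + ω₂ (∂_n v)_2` on `Γ(t)`, with `n = n_1`. -/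
def avgNormalDeriv (ω₁ ω₂ : ℝ) (t : ℝ) (v : BrokenFn d) (s : E d) : ℝ :=
  ω₁ * inner ℝ (M.n1 t s) (sideLimit (gradient v.val) s (M.n1 t s)) +
    ω₂ * inner ℝ (M.n1 t s) (sideLimit (gradient v.val) s (M.n2 t s))

/-- The jump `[∇v] = (∇v)_1 - (∇v)_2` on the overlap region. -/
def _root_.CutFEM.BrokenFn.gradJump (v : BrokenFn d) (x : E d) : E d :=
  gradient v.ext1 x - gradient v.ext2 x

/-- The integral over `A ⊆ Γ(t)` with respect to the `(d-1)`-dimensional surface measure (the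
counting measure for `d = 1`). -/
def _root_.CutFEM.surfaceIntegral (A : Set (E d)) (f : E d → ℝ) : ℝ :=
  ∫ s in A, f s ∂(Measure.euclideanHausdorffMeasure (d - 1))

/-- The bilinear form `A_{h,t}` with stabilization parameter `γ`. -/
def form (γ ω₁ ω₂ : ℝ) (t : ℝ) (w v : BrokenFn d) : ℝ :=
  (∫ x in M.Ω1 t, inner ℝ (gradient w.val x) (gradient v.val x)) +
    (∫ x in M.Ω2 t, inner ℝ (gradient w.val x) (gradient v.val x)) -
    surfaceIntegral (M.Γ t) (fun s => M.avgNormalDeriv ω₁ ω₂ t w s * M.jump t v s) -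
    surfaceIntegral (M.Γ t) (fun s => M.avgNormalDeriv ω₁ ω₂ t v s * M.jump t w s) +
    surfaceIntegral (M.Γ t) (fun s => γ * (M.meshSize s)⁻¹ * M.jump t w s * M.jump t v s) +
    ∫ x in M.ΩO t, inner ℝ (w.gradJump x) (v.gradJump x)

/-- `‖f‖_{1/2,h,Γ(t)}^2`. -/
def normHalfSq (t : ℝ) (f : E d → ℝ) : ℝ :=
  ∑ᶠ s ∈ M.cutCells t, (hK s)⁻¹ * surfaceIntegral (hull s ∩ M.Γ t) (fun x => f x ^ 2)

/-- `‖f‖_{-1/2,h,Γ(t)}^2`. -/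
def normNegHalfSq (t : ℝ) (f : E d → ℝ) : ℝ :=
  ∑ᶠ s ∈ M.cutCells t, hK s * surfaceIntegral (hull s ∩ M.Γ t) (fun x => f x ^ 2)

/-- The square of the energy norm. -/
def energySq (ω₁ ω₂ : ℝ) (t : ℝ) (w : BrokenFn d) : ℝ :=
  (∫ x in M.Ω1 t, ‖gradient w.val x‖ ^ 2) + (∫ x in M.Ω2 t, ‖gradient w.val x‖ ^ 2) +
    M.normNegHalfSq t (M.avgNormalDeriv ω₁ ω₂ t w) + M.normHalfSq t (M.jump t w) +
    ∫ x in M.ΩO t, ‖w.gradJump x‖ ^ 2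

end OverlappingMeshes

end CutFEM

end

/-! Write `E` for the gradient energy on `Ω1` and `Ω2` plus the stabilization on `ΩO`, and `J` for
the integral of the squared jump over `Γ`. On the diagonal only the cross term `-2 ∫_Γ ⟨∂ₙv⟩[v]` can
be negative. All cells and time steps are comparable to one length `k`. Everything rests on the
trace inequality `k ∫_Γ ⟨∂ₙv⟩² ≤ C E` (`exists_integral_avgNormalDeriv_sq_le`). Young's inequality
then bounds the cross term by `E / 2 + 2 C J / k`, and a large penalty absorbs the second summand.
The form is thus at least `E / 2 + J / k`, and this controls the energy norm.

For the trace inequality, equivalence of norms on polynomials of bounded degree, scaled to size `k`,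
bounds `|∇v|²` pointwise on a cell by `k⁻ᵈ` times its energy on the whole cell
(`exists_polyGrad_sq_le_integral_cell`). The part of `Γ` in a cell has surface measure at most of
order `kᵈ⁻¹`, because `Γ` lies on facets of boundedly many nearby cells
(`exists_hausdorff_Γ_inter_closedBall_le`). Cells of `TG` lie in the closure of `G`, so their energy
is part of `E`. A cut background cell may meet `Ω1` only in a thin sliver. The rest of it lies, up
to a null set, in `ΩO`, where `∇v₀ = [∇v] + ∇v_G`, and so the stabilization pays for the covered
part (`sum_integral_ext1_le`).

Jump and average are defined by one-sided limits along normals. To identify them with polynomial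
expressions, `exists_isSide` shows that off a null set of `Γ` the interface is flat and each side is
locally covered by one cell. -/

open Set Filter Topology MeasureTheory

noncomputable section

namespace CutFEM

/-! ### Polynomial functions and inverse estimates on balls. -/

/-- The polynomial function on `ℝ^d` given by `q`. -/
abbrev polyFn {d : ℕ} (q : MvPolynomial (Fin d) ℝ) (x : E d) : ℝ :=
  MvPolynomial.eval (fun i => x i) q

theorem continuous_polyFn {d : ℕ} (q : MvPolynomial (Fin d) ℝ) : Continuous (polyFn q) :=
  (MvPolynomial.continuous_eval q).comp (by fun_prop)

/-- The gradient of the polynomial function given by `q`. -/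
def polyGrad {d : ℕ} (q : MvPolynomial (Fin d) ℝ) (x : E d) : E d :=
  WithLp.toLp 2 fun i => polyFn (MvPolynomial.pderiv i q) x

theorem continuous_polyGrad {d : ℕ} (q : MvPolynomial (Fin d) ℝ) : Continuous (polyGrad q) :=
  (PiLp.continuous_toLp 2 _).comp (continuous_pi fun _ => continuous_polyFn _)

theorem norm_polyGrad_sq {d : ℕ} (q : MvPolynomial (Fin d) ℝ) (x : E d) :
    ‖polyGrad q x‖ ^ 2 = ∑ i, polyFn (MvPolynomial.pderiv i q) x ^ 2 := by
  rw [EuclideanSpace.real_norm_sq_eq]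
  rfl

theorem hasGradientAt_polyFn {d : ℕ} (q : MvPolynomial (Fin d) ℝ) (x : E d) :
    HasGradientAt (polyFn q) (polyGrad q x) x := by
  rw [hasGradientAt_iff_hasFDerivAt]
  induction q using MvPolynomial.induction_on with
  | C a =>
    have h : polyGrad (MvPolynomial.C a) x = 0 := by
      ext i
      simp [polyGrad, polyFn]
    rw [h, map_zero]
    have h2 : (polyFn (MvPolynomial.C a) : E d → ℝ) = fun _ => a := by
      ext y
      simp [polyFn]
    rw [h2]
    exact hasFDerivAt_const (𝕜 := ℝ) a x
  | add q r hq hr =>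
    have h : polyGrad (q + r) x = polyGrad q x + polyGrad r x := by
      ext i
      simp [polyGrad, polyFn]
    rw [h, map_add]
    have h2 : (polyFn (q + r) : E d → ℝ) = polyFn q + polyFn r := by
      ext y
      simp [polyFn]
    rw [h2]
    exact hq.add hr
  | mul_X q j hq =>
    have hX : HasFDerivAt (fun y : E d => y j) (EuclideanSpace.proj j : E d →L[ℝ] ℝ) x :=
      (EuclideanSpace.proj j : E d →L[ℝ] ℝ).hasFDerivAt
    have := hq.mul hX
    have h2 : (polyFn (q * MvPolynomial.X j) : E d → ℝ) = polyFn q * fun y => y j := by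
      ext y
      simp [polyFn]
    rw [h2]
    refine this.congr_fderiv ?_
    ext y
    have hp : (EuclideanSpace.proj j : E d →L[ℝ] ℝ) y = y j := rfl
    simp only [add_apply, smul_apply, hp,
      InnerProductSpace.toDual_apply_apply, PiLp.inner_apply, polyGrad,
      MvPolynomial.pderiv_mul, MvPolynomial.pderiv_X, smul_eq_mul, polyFn, map_add, map_mul,
      MvPolynomial.eval_X, RCLike.inner_apply, conj_trivial, mul_add, Finset.sum_add_distrib,
      Finset.mul_sum]
    rw [add_comm]
    congr 1
    · refine Finset.sum_congr rfl fun i _ => ?_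
      ring
    · rw [Finset.sum_eq_single j]
      · simp
        ring
      · intro b _ hb
        simp [hb.symm]
      · simp

theorem gradient_polyFn {d : ℕ} (q : MvPolynomial (Fin d) ℝ) (x : E d) :
    gradient (polyFn q) x = polyGrad q x :=
  (hasGradientAt_polyFn q x).gradient

theorem totalDegree_pderiv_le {d : ℕ} (q : MvPolynomial (Fin d) ℝ) (i : Fin d) :
    (MvPolynomial.pderiv i q).totalDegree ≤ q.totalDegree := by
  conv_lhs => rw [q.as_sum, map_sum]
  refine MvPolynomial.totalDegree_finsetSum_le fun m hm => ?_
  rw [MvPolynomial.pderiv_monomial]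
  refine (MvPolynomial.totalDegree_monomial_le _ _).trans
    (le_trans ?_ (MvPolynomial.le_totalDegree hm))
  rw [Finsupp.sum_fintype _ _ (by simp), Finsupp.sum_fintype _ _ (by simp)]
  exact Finset.sum_le_sum fun j _ => by simp

/-- Polynomial functions are stable under affine changes of variables. -/
theorem exists_polyFn_comp_affine {d : ℕ} (q : MvPolynomial (Fin d) ℝ) (x : E d) (k : ℝ) :
    ∃ r : MvPolynomial (Fin d) ℝ, r.totalDegree ≤ q.totalDegree ∧
      ∀ z, polyFn r z = polyFn q (x + k • z) := by
  refine ⟨MvPolynomial.bind₁ (fun i => MvPolynomial.C (x i) + MvPolynomial.C k * MvPolynomial.X i) q,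
    ?_, fun z => ?_⟩
  · rw [MvPolynomial.bind₁, MvPolynomial.aeval_def, MvPolynomial.eval₂_eq']
    refine MvPolynomial.totalDegree_finsetSum_le fun m hm => ?_
    refine le_trans (MvPolynomial.totalDegree_mul _ _) ?_
    rw [MvPolynomial.algebraMap_eq, MvPolynomial.totalDegree_C, zero_add]
    refine le_trans (MvPolynomial.totalDegree_finsetProd _ _)
      (le_trans ?_ (MvPolynomial.le_totalDegree hm))
    rw [Finsupp.sum_fintype _ _ (by simp)]
    refine Finset.sum_le_sum fun j _ => ?_
    refine (MvPolynomial.totalDegree_pow _ _).trans ?_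
    refine (Nat.mul_le_mul_left _ (?_ : _ ≤ 1)).trans (by simp)
    refine (MvPolynomial.totalDegree_add _ _).trans (max_le (by simp) ?_)
    exact (MvPolynomial.totalDegree_mul _ _).trans (by simp)
  · have h : (fun i => MvPolynomial.eval (fun i => z i) (MvPolynomial.C (x i) +
        MvPolynomial.C k * MvPolynomial.X i)) = fun i => (x + k • z) i := by
      ext i
      simp
    rw [polyFn, polyFn, ← h, MvPolynomial.eval, MvPolynomial.eval₂Hom_bind₁]
    rfl

/-- Identity theorem for analytic functions. It makes the `L²` norm on a small ball definite on
polynomials. -/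
theorem eq_zero_of_polyFn_eventually_eq_zero {d : ℕ} (q : MvPolynomial (Fin d) ℝ)
    (h : ∀ᶠ x in 𝓝 (0 : E d), polyFn q x = 0) : q = 0 := by
  have h1 : AnalyticOnNhd ℝ (fun x : Fin d → ℝ => MvPolynomial.eval x q) univ :=
    AnalyticOnNhd.eval_mvPolynomial q
  have h2 : (fun x : Fin d → ℝ => MvPolynomial.eval x q) =ᶠ[𝓝 0] fun _ => 0 := by
    have : Tendsto (fun x : Fin d → ℝ => (WithLp.toLp 2 x : E d)) (𝓝 0) (𝓝 0) :=
      (PiLp.continuous_toLp 2 _).tendsto' _ _ rfl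
    exact this.eventually h
  have h3 := h1.eq_of_eventuallyEq analyticOnNhd_const h2
  refine MvPolynomial.funext fun x => ?_
  simpa using congrFun h3 x

/-- Equivalence of norms on polynomials of bounded degree: the maximum norm on a large ball is
controlled by the `L²` norm on a small ball. -/
theorem exists_polyFn_sq_le_integral_ball_zero (d p : ℕ) {ρ R : ℝ} (hρ : 0 < ρ) :
    ∃ C : ℝ, 0 < C ∧ ∀ q : MvPolynomial (Fin d) ℝ, q.totalDegree ≤ p →
      ∀ y ∈ Metric.closedBall (0 : E d) R,
        polyFn q y ^ 2 ≤ C * ∫ z in Metric.ball (0 : E d) ρ, polyFn q z ^ 2 := by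
  let V := MvPolynomial.restrictTotalDegree (Fin d) ℝ p
  let b := Module.finBasis ℝ V
  let n := Module.finrank ℝ V
  let f : (Fin n → ℝ) → E d → ℝ := fun c z => ∑ i, c i * polyFn (b i : MvPolynomial (Fin d) ℝ) z
  have hf : ∀ c z, f c z = polyFn ((∑ i, c i • b i : V) : MvPolynomial (Fin d) ℝ) z := by
    intro c z
    simp [f, polyFn, MvPolynomial.smul_eval]
  have hinteg : ∀ g : E d → ℝ, Continuous g → IntegrableOn g (Metric.ball (0 : E d) ρ) := fun g hg =>
    (hg.continuousOn.integrableOn_compact (isCompact_closedBall 0 ρ)).mono_set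
      Metric.ball_subset_closedBall
  have hfc : ∀ c, Continuous (f c) := fun c =>
    continuous_finsetSum _ fun i _ => continuous_const.mul (continuous_polyFn _)
  let Φ : (Fin n → ℝ) → ℝ := fun c => ∫ z in Metric.ball (0 : E d) ρ, f c z ^ 2
  have hΦc : Continuous Φ := by
    have : Φ = fun c => ∑ i, ∑ j, c i * c j * ∫ z in Metric.ball (0 : E d) ρ,
        polyFn (b i : MvPolynomial (Fin d) ℝ) z * polyFn (b j : MvPolynomial (Fin d) ℝ) z := by
      ext c
      have h1 : ∀ z, f c z ^ 2 = ∑ i, ∑ j, c i * c j *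
          (polyFn (b i : MvPolynomial (Fin d) ℝ) z * polyFn (b j : MvPolynomial (Fin d) ℝ) z) := by
        intro z
        simp only [f, sq, Finset.sum_mul_sum]
        exact Finset.sum_congr rfl fun i _ => Finset.sum_congr rfl fun j _ => by ring
      have hc : ∀ i j, Continuous fun z => c i * c j *
          (polyFn (b i : MvPolynomial (Fin d) ℝ) z * polyFn (b j : MvPolynomial (Fin d) ℝ) z) := fun i j =>
        (((continuous_polyFn (b i : MvPolynomial (Fin d) ℝ)).mul
          (continuous_polyFn (b j : MvPolynomial (Fin d) ℝ))).const_mul _ :)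
      simp only [Φ, h1]
      rw [integral_finsetSum _ fun i _ => hinteg _ (continuous_finsetSum _ fun j _ => hc i j)]
      refine Finset.sum_congr rfl fun i _ => ?_
      rw [integral_finsetSum _ fun j _ => hinteg _ (hc i j)]
      exact Finset.sum_congr rfl fun j _ => integral_const_mul _ _
    rw [this]
    fun_prop
  -- `Φ` is a continuous quadratic form in the coefficients. Definiteness and compactness of the
  -- unit sphere give a positive lower bound `m`, which extends to `m ‖c‖² ≤ Φ c` by homogeneity.
  have hΦpos : ∀ c ∈ Metric.sphere (0 : Fin n → ℝ) 1, 0 < Φ c := by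
    intro c hc
    refine lt_of_le_of_ne (integral_nonneg fun z => sq_nonneg _) fun h0 => ?_
    have h1 := (integral_eq_zero_iff_of_nonneg (fun z => sq_nonneg _)
      (hinteg _ ((hfc c).pow 2))).1 h0.symm
    have h2 : EqOn (fun z => f c z ^ 2) (fun _ => 0) (Metric.ball 0 ρ) := by
      refine Measure.eqOn_open_of_ae_eq h1 Metric.isOpen_ball ((hfc c).pow 2).continuousOn
        continuousOn_const
    have h3 : ((∑ i, c i • b i : V) : MvPolynomial (Fin d) ℝ) = 0 := by
      refine eq_zero_of_polyFn_eventually_eq_zero _ ?_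
      filter_upwards [Metric.ball_mem_nhds (0 : E d) hρ] with z hz
      rw [← hf]
      exact pow_eq_zero_iff two_ne_zero |>.1 (h2 hz)
    have h4 : ∑ i, c i • b i = 0 := Subtype.ext h3
    have h5 : c = 0 := funext fun i => Fintype.linearIndependent_iff.1 b.linearIndependent c h4 i
    simp [h5] at hc
  obtain ⟨m, hm, hmΦ⟩ := (isCompact_sphere (0 : Fin n → ℝ) 1).exists_forall_le'
    hΦc.continuousOn hΦpos
  have hbd : ∀ i, ∃ B, ∀ y ∈ Metric.closedBall (0 : E d) R,
      ‖polyFn (b i : MvPolynomial (Fin d) ℝ) y‖ ≤ B := fun i =>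
    (isCompact_closedBall 0 R).exists_bound_of_continuousOn (continuous_polyFn _).continuousOn
  choose B hB using hbd
  -- The summand `1` only keeps the constant positive if all the bounds `B i` vanish.
  refine ⟨((∑ i, |B i|) ^ 2 + 1) / m, by positivity, fun q hq y hy => ?_⟩
  let c : Fin n → ℝ := fun i => b.repr ⟨q, (MvPolynomial.mem_restrictTotalDegree _ _ _).2 hq⟩ i
  have hc : ∀ z, polyFn q z = f c z := by
    intro z
    rw [hf, b.sum_repr]
  have h1 : m * ‖c‖ ^ 2 ≤ Φ c := by
    rcases eq_or_ne c 0 with h0 | h0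
    · rw [h0]
      simp only [norm_zero]
      have : 0 ≤ Φ 0 := integral_nonneg fun z => sq_nonneg _
      simpa using this
    · have hc0 : ‖c‖ ≠ 0 := norm_ne_zero_iff.2 h0
      have h2 := hmΦ (‖c‖⁻¹ • c) (by simp [norm_smul, hc0])
      have h3 : Φ (‖c‖⁻¹ • c) = (‖c‖ ^ 2)⁻¹ * Φ c := by
        simp only [Φ]
        rw [← integral_const_mul]
        congr 1
        ext z
        simp only [f, Pi.smul_apply, smul_eq_mul, mul_assoc, ← Finset.mul_sum]
        ring
      rw [h3] at h2
      have hcp : 0 < ‖c‖ ^ 2 := by positivity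
      calc m * ‖c‖ ^ 2 ≤ ((‖c‖ ^ 2)⁻¹ * Φ c) * ‖c‖ ^ 2 := by gcongr
        _ = Φ c := by field_simp
  have h2 : |f c y| ≤ ‖c‖ * ∑ i, |B i| := by
    rw [Finset.mul_sum]
    refine (Finset.abs_sum_le_sum_abs _ _).trans (Finset.sum_le_sum fun i _ => ?_)
    rw [abs_mul]
    exact mul_le_mul (norm_le_pi_norm c i) ((hB i y hy).trans (le_abs_self _)) (abs_nonneg _)
      (norm_nonneg _)
  have h3 : (∫ z in Metric.ball (0 : E d) ρ, polyFn q z ^ 2) = Φ c := by simp only [Φ, hc]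
  rw [h3, hc y]
  calc f c y ^ 2 = |f c y| ^ 2 := (sq_abs _).symm
    _ ≤ (‖c‖ * ∑ i, |B i|) ^ 2 := by gcongr
    _ = (∑ i, |B i|) ^ 2 / m * (m * ‖c‖ ^ 2) := by field_simp
    _ ≤ ((∑ i, |B i|) ^ 2 + 1) / m * Φ c := by
        gcongr
        linarith

theorem setIntegral_ball_scaling {d : ℕ} (f : E d → ℝ) (x : E d) {k ρ : ℝ} (hk : 0 < k) :
    ∫ z in Metric.ball (0 : E d) ρ, f (x + k • z) =
      (k ^ d)⁻¹ * ∫ y in Metric.ball x (ρ * k), f y := by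
  rw [← integral_indicator measurableSet_ball, ← integral_indicator measurableSet_ball]
  have h1 : ∀ z, (Metric.ball (0 : E d) ρ).indicator (fun z => f (x + k • z)) z =
      (fun w => (Metric.ball x (ρ * k)).indicator f (x + w)) (k • z) := by
    intro z
    have : z ∈ Metric.ball (0 : E d) ρ ↔ x + k • z ∈ Metric.ball x (ρ * k) := by
      simp only [Metric.mem_ball, dist_self_add_left, dist_zero_right, norm_smul, Real.norm_eq_abs,
        abs_of_pos hk]
      rw [mul_comm ρ k, mul_lt_mul_iff_right₀ hk]
    by_cases hz : z ∈ Metric.ball (0 : E d) ρ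
    · simp only [indicator_of_mem hz, indicator_of_mem (this.1 hz)]
    · simp only [indicator_of_notMem hz, indicator_of_notMem (fun h => hz (this.2 h))]
  simp only [h1]
  rw [Measure.integral_comp_smul volume (fun w => (Metric.ball x (ρ * k)).indicator f (x + w)),
    integral_add_left_eq_self]
  simp [abs_of_pos hk]

/-- The inverse estimate for polynomials, at scale `k`. -/
theorem exists_polyFn_sq_le_integral_ball (d p : ℕ) {ρ R : ℝ} (hρ : 0 < ρ) :
    ∃ C : ℝ, 0 < C ∧ ∀ q : MvPolynomial (Fin d) ℝ, q.totalDegree ≤ p →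
      ∀ (x : E d) (k : ℝ), 0 < k → ∀ y ∈ Metric.closedBall x (R * k),
        polyFn q y ^ 2 ≤ C * (k ^ d)⁻¹ * ∫ z in Metric.ball x (ρ * k), polyFn q z ^ 2 := by
  obtain ⟨C, hC, H⟩ := exists_polyFn_sq_le_integral_ball_zero d p (R := R) hρ
  refine ⟨C, hC, fun q hq x k hk y hy => ?_⟩
  obtain ⟨r, hr, hrq⟩ := exists_polyFn_comp_affine q x k
  have hy' : k⁻¹ • (y - x) ∈ Metric.closedBall (0 : E d) R := by
    rw [mem_closedBall_zero_iff, norm_smul, norm_inv, Real.norm_eq_abs, abs_of_pos hk,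
      ← dist_eq_norm, inv_mul_le_iff₀ hk, mul_comm]
    exact hy
  have h := H r (hr.trans hq) _ hy'
  simp only [hrq, smul_inv_smul₀ hk.ne', add_sub_cancel] at h
  rwa [setIntegral_ball_scaling (fun z => polyFn q z ^ 2) x hk, ← mul_assoc] at h

/-- The inverse estimate for gradients of polynomials, at scale `k`. -/
theorem exists_polyGrad_sq_le_integral_ball (d p : ℕ) {ρ R : ℝ} (hρ : 0 < ρ) :
    ∃ C : ℝ, 0 < C ∧ ∀ q : MvPolynomial (Fin d) ℝ, q.totalDegree ≤ p →
      ∀ (x : E d) (k : ℝ), 0 < k → ∀ y ∈ Metric.closedBall x (R * k),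
        ‖polyGrad q y‖ ^ 2 ≤ C * (k ^ d)⁻¹ * ∫ z in Metric.ball x (ρ * k), ‖polyGrad q z‖ ^ 2 := by
  obtain ⟨C, hC, H⟩ := exists_polyFn_sq_le_integral_ball d p (R := R) hρ
  refine ⟨C, hC, fun q hq x k hk y hy => ?_⟩
  simp only [norm_polyGrad_sq]
  rw [integral_finsetSum, Finset.mul_sum]
  · exact Finset.sum_le_sum fun i _ => H _ ((totalDegree_pderiv_le q i).trans hq) x k hk y hy
  · exact fun i _ => (((continuous_polyFn _).pow 2).continuousOn.integrableOn_compact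
      (isCompact_closedBall x (ρ * k))).mono_set Metric.ball_subset_closedBall

/-! ### Simplices as intersections of half-spaces. -/

/-- A full-dimensional simplex is an intersection of half-spaces with unit normals. -/
theorem exists_halfspaces {d : ℕ} (hd : 1 ≤ d) {s : Finset (E d)}
    (hs : AffineIndependent ℝ ((↑) : s → E d)) (hcard : s.card = d + 1) :
    ∃ F : Finset (E d × ℝ), F.card ≤ d + 1 ∧ (∀ c ∈ F, ‖c.1‖ = 1) ∧
      hull s = {x | ∀ c ∈ F, c.2 ≤ inner ℝ c.1 x} := by
  classical
  have hspan : affineSpan ℝ (range ((↑) : s → E d)) = ⊤ := by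
    rw [hs.affineSpan_eq_top_iff_card_eq_finrank_add_one]
    simp [hcard]
  let b : AffineBasis s ℝ (E d) := ⟨(↑), hs, hspan⟩
  have hhull : hull s = {x | ∀ i, 0 ≤ b.coord i x} := by
    rw [← b.convexHull_eq_nonneg_coord, hull]
    congr 1
    exact Subtype.range_coe.symm
  let a : s → E d := fun i => (InnerProductSpace.toDual ℝ (E d)).symm
    (LinearMap.toContinuousLinearMap (b.coord i).linear)
  have ha : ∀ i x, inner ℝ (a i) x = (b.coord i).linear x := by
    intro i x
    simp [a]
  have hb : ∀ i x, b.coord i x = inner ℝ (a i) x + b.coord i 0 := by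
    intro i x
    rw [ha]
    simpa using congrFun (b.coord i).decomp x
  -- A barycentric coordinate is `1` at its own vertex and `0` at another one, which exists as `d ≥
  -- 1`. So its linear part is nonzero and can be normalized.
  have ha0 : ∀ i, a i ≠ 0 := by
    intro i h
    have : Nontrivial s := by
      rw [← Fintype.one_lt_card_iff_nontrivial, Fintype.card_coe]
      omega
    obtain ⟨j, hj⟩ := exists_ne i
    have h1 := hb i (b i)
    have h2 := hb i (b j)
    rw [h, inner_zero_left] at h1 h2
    rw [b.coord_apply_eq] at h1
    rw [b.coord_apply_ne hj.symm] at h2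
    linarith
  refine ⟨Finset.univ.image fun i => (‖a i‖⁻¹ • a i, -(‖a i‖⁻¹ * b.coord i 0)), ?_, ?_, ?_⟩
  · refine Finset.card_image_le.trans ?_
    simp [hcard]
  · intro c hc
    obtain ⟨i, -, rfl⟩ := Finset.mem_image.1 hc
    simp [norm_smul, ha0 i]
  · rw [hhull]
    ext x
    simp only [mem_ofPred_eq, Finset.mem_image, Finset.mem_univ, true_and, forall_exists_index,
      forall_apply_eq_imp_iff, inner_smul_left, conj_trivial]
    refine forall_congr' fun i => ?_
    have : 0 < ‖a i‖⁻¹ := inv_pos.2 (norm_pos_iff.2 (ha0 i))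
    rw [hb i x, ← sub_nonneg (a := ‖a i‖⁻¹ * _), sub_neg_eq_add, ← mul_add,
      mul_nonneg_iff_of_pos_left this]

open Classical in
/-- The facets of the simplex with vertex set `s`, given by inner unit normals and offsets. -/
def facets {d : ℕ} (s : Finset (E d)) : Finset (E d × ℝ) :=
  if h : ∃ F : Finset (E d × ℝ), F.card ≤ d + 1 ∧ (∀ c ∈ F, ‖c.1‖ = 1) ∧
      hull s = {x | ∀ c ∈ F, c.2 ≤ inner ℝ c.1 x} then h.choose else ∅

section cells

variable {d : ℕ} {T : Geometry.SimplicialComplex ℝ (E d)} {s : Finset (E d)}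

theorem facets_spec (hd : 1 ≤ d) (hs : s ∈ cells T) :
    (facets s).card ≤ d + 1 ∧ (∀ c ∈ facets s, ‖c.1‖ = 1) ∧
      hull s = {x | ∀ c ∈ facets s, c.2 ≤ inner ℝ c.1 x} := by
  have h := exists_halfspaces hd (T.indep hs.1) hs.2
  rw [facets, dif_pos h]
  exact h.choose_spec

theorem isCompact_hull (s : Finset (E d)) : IsCompact (hull s) :=
  s.finite_toSet.isCompact_convexHull ℝ

theorem isClosed_hull (s : Finset (E d)) : IsClosed (hull s) := (isCompact_hull s).isClosed

theorem mem_hull_iff (hd : 1 ≤ d) (hs : s ∈ cells T) {x : E d} :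
    x ∈ hull s ↔ ∀ c ∈ facets s, c.2 ≤ inner ℝ c.1 x := by
  conv_lhs => rw [(facets_spec hd hs).2.2]
  rfl

theorem exists_facet_of_notMem_interior (hd : 1 ≤ d) (hs : s ∈ cells T) {x : E d}
    (hx : x ∈ hull s) (hx' : x ∉ interior (hull s)) : ∃ c ∈ facets s, inner ℝ c.1 x = c.2 := by
  by_contra! h
  refine hx' (mem_interior_iff_mem_nhds.2 ?_)
  have : ∀ᶠ y in 𝓝 x, ∀ c ∈ facets s, c.2 < inner ℝ c.1 y := by
    rw [Filter.eventually_all_finset]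
    intro c hc
    have hlt : c.2 < inner ℝ c.1 x := lt_of_le_of_ne ((mem_hull_iff hd hs).1 hx c hc) (h c hc).symm
    exact (continuous_const.inner continuous_id).continuousAt.eventually_const_lt hlt
  filter_upwards [this] with y hy
  exact (mem_hull_iff hd hs).2 fun c hc => (hy c hc).le

/-- By conformity two cells meet inside the hull of their common vertices. Distinct cells share at
most `d` vertices, and these do not span the space. -/
theorem disjoint_interior_hull {s' : Finset (E d)} (hs : s ∈ cells T) (hs' : s' ∈ cells T)
    (hne : s ≠ s') : Disjoint (interior (hull s)) (interior (hull s')) := by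
  classical
  rw [Set.disjoint_iff_inter_eq_empty, ← interior_inter]
  have hsub : interior (hull s ∩ hull s') ⊆ interior (convexHull ℝ ((s ∩ s' : Finset (E d)) : Set (E d))) := by
    refine interior_mono ?_
    rw [Finset.coe_inter]
    exact T.inter_subset_convexHull hs.1 hs'.1
  by_contra h
  have hne' := (nonempty_iff_ne_empty.2 h).mono hsub
  rw [interior_convexHull_nonempty_iff_affineSpan_eq_top] at hne'
  have hlt : (s ∩ s').card < s.card := by
    refine Finset.card_lt_card (Finset.inter_subset_left.ssubset_of_ne fun he => hne ?_)
    refine Finset.eq_of_subset_of_card_le (Finset.inter_eq_left.1 he) ?_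
    rw [hs.2, hs'.2]
  have hind : AffineIndependent ℝ ((↑) : (s ∩ s' : Finset (E d)) → E d) :=
    (T.indep hs.1).mono (by simp)
  have h2 := (hind.affineSpan_eq_top_iff_card_eq_finrank_add_one).1 (by rwa [Subtype.range_coe])
  have h3 := hs.2
  simp only [Fintype.card_coe, finrank_euclideanSpace, Fintype.card_fin] at h2
  omega

end cells

/-! ### Cells at a common scale and their number near a point. -/

/-- The simplex with vertex set `s` is shape regular and of size comparable with `k`. -/
structure IsCellAtScale {d : ℕ} (κ ρ k : ℝ) (s : Finset (E d)) : Prop where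
  hK_le : hK s ≤ κ * k
  le_hK : k ≤ κ * hK s
  exists_ball : ∃ x, Metric.ball x (ρ * k) ⊆ interior (hull s) ∧
    hull s ⊆ Metric.closedBall x (κ * k)

/-- The number of cells of a mesh at scale `k` which meet a ball of radius `R * k` is bounded. -/
theorem card_cells_meeting_ball_le {d : ℕ} {T : Geometry.SimplicialComplex ℝ (E d)} {κ ρ k R : ℝ}
    (hκ : 0 < κ) (hρ : 0 < ρ) (hk : 0 < k) (hR : 0 ≤ R) (hd : 1 ≤ d) (y : E d)
    (A : Finset (Finset (E d))) (hA : ∀ s ∈ A, s ∈ cells T ∧ IsCellAtScale κ ρ k s ∧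
      (hull s ∩ Metric.closedBall y (R * k)).Nonempty) :
    (A.card : ℝ) ≤ ((R + κ + ρ) / ρ) ^ d := by
  have : Nonempty (Fin d) := ⟨⟨0, hd⟩⟩
  choose! x hx hx' using fun s hs => (hA s hs).2.1.exists_ball
  -- Volume comparison: the inscribed balls of radius `ρ k` are disjoint and all lie in the ball of
  -- radius `(R + κ + ρ) k` about `y`.
  have hdisj : (A : Set (Finset (E d))).PairwiseDisjoint fun s => Metric.ball (x s) (ρ * k) := by
    intro s hs s' hs' hne
    exact (disjoint_interior_hull (hA s hs).1 (hA s' hs').1 hne).mono (hx s hs) (hx s' hs')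
  have hsub : (⋃ s ∈ A, Metric.ball (x s) (ρ * k)) ⊆ Metric.ball y ((R + κ + ρ) * k) := by
    refine iUnion₂_subset fun s hs z hz => ?_
    obtain ⟨w, hw, hwy⟩ := (hA s hs).2.2
    have h1 := hx' s hs hw
    rw [Metric.mem_ball] at hz ⊢
    rw [Metric.mem_closedBall] at h1 hwy
    have h2 := dist_triangle4 z (x s) w y
    rw [dist_comm (x s) w] at h2
    linarith
  have hmeas : ∑ s ∈ A, volume.real (Metric.ball (x s) (ρ * k)) ≤
      volume.real (Metric.ball y ((R + κ + ρ) * k)) := by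
    rw [← measureReal_biUnion_finset hdisj (fun _ _ => measurableSet_ball)
      (fun _ _ => measure_ball_lt_top.ne)]
    exact measureReal_mono hsub measure_ball_lt_top.ne
  have hpos : 0 < volume.real (Metric.ball (0 : E d) 1) :=
    ENNReal.toReal_pos (Metric.measure_ball_pos _ _ one_pos).ne' measure_ball_lt_top.ne
  have hball : ∀ (z : E d) (r : ℝ), 0 < r → volume.real (Metric.ball z r) =
      r ^ d * volume.real (Metric.ball (0 : E d) 1) := by
    intro z r hr
    rw [measureReal_def, Measure.addHaar_ball_of_pos volume z hr, ENNReal.toReal_mul,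
      ENNReal.toReal_ofReal (by positivity), measureReal_def]
    simp
  simp only [hball _ _ (show 0 < ρ * k by positivity),
    hball _ _ (show 0 < (R + κ + ρ) * k by positivity), Finset.sum_const,
    nsmul_eq_mul, ← mul_assoc] at hmeas
  have h1 := le_of_mul_le_mul_right hmeas hpos
  rw [div_pow, le_div_iff₀ (by positivity)]
  rw [mul_pow, mul_pow, ← mul_assoc] at h1
  exact le_of_mul_le_mul_right h1 (by positivity)

/-! ### Surface measure of pieces of hyperplanes. -/

/-- The surface measure of the part of a hyperplane in a ball. -/
theorem exists_hausdorff_hyperplane_inter_closedBall_le {d : ℕ} (hd : 1 ≤ d) :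
    ∃ C : ℝ, 0 < C ∧ ∀ (a : E d) (b : ℝ), ‖a‖ = 1 → ∀ (x : E d) (R : ℝ), 0 ≤ R →
      Measure.euclideanHausdorffMeasure (d - 1) ({y | inner ℝ a y = b} ∩ Metric.closedBall x R) ≤
        ENNReal.ofReal (C * R ^ (d - 1)) := by
  obtain ⟨n, rfl⟩ : ∃ n, d = n + 1 := ⟨d - 1, by omega⟩
  simp only [Nat.add_sub_cancel]
  refine ⟨2 ^ n * volume.real (Metric.closedBall (0 : E n) 1), ?_, fun a b ha x R hR => ?_⟩
  · have : 0 < volume.real (Metric.closedBall (0 : E n) 1) :=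
      ENNReal.toReal_pos (Metric.measure_closedBall_pos _ _ one_pos).ne'
        measure_closedBall_lt_top.ne
    positivity
  rcases ({y | inner ℝ a y = b} ∩ Metric.closedBall x R).eq_empty_or_nonempty with h | ⟨z, hz, hzx⟩
  · simp [h]
  have : Fact (Module.finrank ℝ (E (n + 1)) = n + 1) := ⟨by simp⟩
  have ha0 : a ≠ 0 := by
    rintro rfl
    simp at ha
  let e := (OrthonormalBasis.fromOrthogonalSpanSingleton (𝕜 := ℝ) n ha0).repr
  let φ : E n → E (n + 1) := fun w => z + ((e.symm w : (ℝ ∙ a)ᗮ) : E (n + 1))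
  have hφ : Isometry φ :=
    (isometry_add_left z).comp (isometry_subtype_coe.comp e.symm.isometry)
  -- The hyperplane is parametrized isometrically from a point `z` of the piece itself rather than
  -- from `x`, so the radius doubles. This is the source of the factor `2 ^ n`.
  have hsub : {y | inner ℝ a y = b} ∩ Metric.closedBall x R ⊆
      φ '' Metric.closedBall (0 : E n) (2 * R) := by
    rintro y ⟨hy, hyx⟩
    have hmem : y - z ∈ (ℝ ∙ a)ᗮ := by
      rw [Submodule.mem_orthogonal_singleton_iff_inner_right, inner_sub_right]
      rw [mem_ofPred_eq] at hy hz
      rw [hy, hz, sub_self]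
    refine ⟨e ⟨y - z, hmem⟩, ?_, ?_⟩
    · rw [mem_closedBall_zero_iff, e.norm_map, Submodule.coe_norm, ← dist_eq_norm]
      have := dist_triangle_right y z x
      rw [Metric.mem_closedBall] at hyx hzx
      change dist y z ≤ _
      linarith
    · simp [φ]
  refine (measure_mono hsub).trans ?_
  rw [hφ.euclideanHausdorffMeasure_image, EuclideanSpace.euclideanHausdorffMeasure_eq_volume,
    Measure.addHaar_closedBall' _ _ (by positivity), mul_right_comm, ← mul_pow,
    ENNReal.ofReal_mul (by positivity)]
  simp [measureReal_def, ENNReal.ofReal_toReal measure_closedBall_lt_top.ne]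

/-- The intersection of two non-parallel hyperplanes has no surface measure. -/
theorem hausdorff_inter_hyperplanes_eq_zero {d : ℕ} {a a' : E d} (ha : ‖a‖ = 1)
    (ha' : ‖a'‖ = 1) (h₁ : a' ≠ a) (h₂ : a' ≠ -a) (b b' : ℝ) :
    Measure.euclideanHausdorffMeasure (d - 1) {y : E d | inner ℝ a y = b ∧ inner ℝ a' y = b'} =
      0 := by
  have hli : LinearIndependent ℝ ![a, a'] := by
    have ha0 : a ≠ 0 := by
      rintro rfl
      simp at ha
    rw [LinearIndependent.pair_iff' ha0]
    intro r hr
    have h3 : |r| = 1 := by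
      have := congrArg norm hr
      rwa [norm_smul, ha, ha', mul_one, Real.norm_eq_abs] at this
    rcases (abs_eq zero_le_one).1 h3 with h | h
    · exact h₁ (by rw [← hr, h, one_smul])
    · exact h₂ (by rw [← hr, h, neg_smul, one_smul])
  let W : Submodule ℝ (E d) := (Submodule.span ℝ (range ![a, a']))ᗮ
  have hW : 2 + Module.finrank ℝ W = d := by
    have h3 := Submodule.finrank_add_finrank_orthogonal (Submodule.span ℝ (range ![a, a']))
    rw [finrank_span_eq_card hli] at h3
    simpa using h3
  rcases {y : E d | inner ℝ a y = b ∧ inner ℝ a' y = b'}.eq_empty_or_nonempty with h | ⟨z, hz, hz'⟩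
  · simp [h]
  let φ : W → E d := fun w => z + w
  have hφ : Isometry φ := (isometry_add_left z).comp isometry_subtype_coe
  have hsub : {y : E d | inner ℝ a y = b ∧ inner ℝ a' y = b'} ⊆ φ '' univ := by
    rintro y ⟨hy, hy'⟩
    refine ⟨⟨y - z, ?_⟩, trivial, by simp [φ]⟩
    rw [Submodule.mem_orthogonal]
    intro u hu
    induction hu using Submodule.span_induction with
    | mem u hu =>
      obtain ⟨i, rfl⟩ := hu
      fin_cases i
      · simp [inner_sub_right, hy, hz]
      · simp [inner_sub_right, hy', hz']
    | zero => simp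
    | add u v _ _ hu hv => rw [inner_add_left, hu, hv, add_zero]
    | smul r u _ hu => rw [inner_smul_left, hu, mul_zero]
  refine measure_mono_null hsub ?_
  rw [Measure.euclideanHausdorffMeasure_def, Measure.smul_apply]
  -- The intersection is contained in an isometric copy of `W`, of Hausdorff dimension `d - 2 < d -
  -- 1`.
  have : μH[((d - 1 : ℕ) : ℝ)] (φ '' univ) = 0 := by
    refine hausdorffMeasure_of_dimH_lt (d := ((d - 1 : ℕ) : NNReal)) ?_
    rw [hφ.dimH_image, Real.dimH_univ_eq_finrank]
    simp only [ENNReal.coe_natCast, Nat.cast_lt]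
    omega
  rw [this, smul_zero]

/-! ### Half-space structure at a point and one-sided limits. -/

section local_structure

variable {d : ℕ}

theorem continuous_inner_sub (s n : E d) : Continuous fun x : E d => inner ℝ (x - s) n := by
  fun_prop

theorem tendsto_add_smul_nhdsGT (s u : E d) :
    Tendsto (fun ε : ℝ => s + ε • u) (𝓝[>] 0) (𝓝 s) :=
  tendsto_nhdsWithin_of_tendsto_nhds
    ((continuous_const.add (continuous_id.smul continuous_const)).tendsto' _ _ (by simp))

/-- An implication between two open half-space conditions which holds near `s` holds globally. -/
theorem inner_neg_of_eventually {s m : E d} {f : E d →L[ℝ] ℝ}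
    (h : ∀ᶠ x in 𝓝 s, inner ℝ (x - s) m < 0 → f (x - s) < 0) {u : E d} (hu : inner ℝ u m < 0) :
    f u < 0 := by
  obtain ⟨ε, hε, hε0⟩ := (((tendsto_add_smul_nhdsGT s u).eventually h).and
    self_mem_nhdsWithin).exists
  have hε0 : 0 < ε := hε0
  simp only [add_sub_cancel_left, inner_smul_left, conj_trivial, map_smul, smul_eq_mul] at hε
  by_contra! h
  exact (mul_nonneg hε0.le h).not_gt (hε (mul_neg_of_pos_of_neg hε0 hu))

/-- If `n ≠ n'`, the direction `n' - n` points into the half-space of `n` but out of that of `n'`.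
Uniqueness lets the chosen `outerNormal` be computed. -/
theorem IsOuterNormal.unique {Ω : Set (E d)} {s n n' : E d} (h : IsOuterNormal Ω s n)
    (h' : IsOuterNormal Ω s n') : n = n' := by
  by_contra hne
  have hlt : inner ℝ n n' < (1 : ℝ) := (inner_lt_one_iff_real_of_norm_eq_one h.1 h'.1).2 hne
  have h1 : ∀ᶠ x in 𝓝 s, inner ℝ (x - s) n < 0 → innerSL ℝ n' (x - s) < 0 := by
    filter_upwards [h.2, h'.2] with x hx hx' hxn
    rw [innerSL_apply_apply, real_inner_comm]
    exact hx'.1 (hx.2 hxn)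
  have h2 := inner_neg_of_eventually h1 (u := n' - n) (by
    rw [inner_sub_left, real_inner_self_eq_norm_sq, h.1, real_inner_comm]
    linarith)
  rw [innerSL_apply_apply, inner_sub_right, real_inner_self_eq_norm_sq, h'.1,
    real_inner_comm] at h2
  linarith

theorem IsOuterNormal.outerNormal_eq {Ω : Set (E d)} {s n : E d} (h : IsOuterNormal Ω s n) :
    outerNormal Ω s = n := by
  have hex : ∃ n, IsOuterNormal Ω s n := ⟨n, h⟩
  rw [outerNormal, dif_pos hex]
  exact hex.choose_spec.unique h

/-- Near `s`, the set `Ω` is a half-space with outer normal `n`, and its closure is contained in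
the simplex with vertex set `K`. -/
structure IsSide (Ω : Set (E d)) (K : Finset (E d)) (s n : E d) : Prop where
  outer : IsOuterNormal Ω s n
  hull : ∀ᶠ x in 𝓝 s, inner ℝ (x - s) n ≤ 0 → x ∈ hull K

namespace IsSide

variable {Ω : Set (E d)} {K : Finset (E d)} {s n : E d}

theorem mem_hull (h : IsSide Ω K s n) : s ∈ CutFEM.hull K :=
  h.hull.self_of_nhds (by simp)

theorem eventually_inner_neg (h : IsSide Ω K s n) :
    ∀ᶠ ε in 𝓝[>] (0 : ℝ), inner ℝ ((s - ε • n) - s) n < 0 := by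
  filter_upwards [self_mem_nhdsWithin] with ε hε
  have hε : 0 < ε := hε
  rw [sub_sub_cancel_left, inner_neg_left, inner_smul_left, real_inner_self_eq_norm_sq, h.outer.1]
  simpa using hε

theorem tendsto_sub_smul (s n : E d) : Tendsto (fun ε : ℝ => s - ε • n) (𝓝[>] 0) (𝓝 s) := by
  simpa [sub_eq_add_neg] using tendsto_add_smul_nhdsGT s (-n)

/-- For small `ε > 0` the points `s - ε n` lie both in `Ω` and in the simplex, where the function is
a single polynomial. -/
theorem sideLimit_eq (h : IsSide Ω K s n) {w f : E d → ℝ} (hw : EqOn w f Ω)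
    {q : MvPolynomial (Fin d) ℝ} (hq : ∀ x ∈ CutFEM.hull K, f x = polyFn q x) :
    sideLimit w s n = f s := by
  refine Tendsto.limUnder_eq ?_
  rw [hq s h.mem_hull]
  refine (((continuous_polyFn q).tendsto s).comp (tendsto_sub_smul s n)).congr' ?_
  filter_upwards [h.eventually_inner_neg, (tendsto_sub_smul s n).eventually h.outer.2,
    (tendsto_sub_smul s n).eventually h.hull] with ε h1 h2 h3
  rw [hw (h2.2 h1), hq _ (h3 h1.le)]
  rfl

theorem sideLimit_gradient_eq (h : IsSide Ω K s n) {w f : E d → ℝ} (hw : EqOn w f Ω)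
    {q : MvPolynomial (Fin d) ℝ} (hq : ∀ x ∈ CutFEM.hull K, f x = polyFn q x) :
    sideLimit (gradient w) s n = polyGrad q s := by
  refine Tendsto.limUnder_eq ?_
  refine (((continuous_polyGrad q).tendsto s).comp (tendsto_sub_smul s n)).congr' ?_
  -- The inequality is strict, so `w` agrees with the polynomial on a whole neighbourhood of `x`,
  -- and the gradients agree too.
  have hev : ∀ᶠ x in 𝓝 s, inner ℝ (x - s) n < 0 → gradient w x = polyGrad q x := by
    filter_upwards [h.outer.2.eventually_nhds, h.hull.eventually_nhds] with x h2 h3 h1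
    have h4 : ∀ᶠ y in 𝓝 x, inner ℝ (y - s) n < 0 :=
      (continuous_inner_sub s n).continuousAt.eventually_lt_const h1
    rw [← gradient_polyFn]
    have : w =ᶠ[𝓝 x] polyFn q := by
      filter_upwards [h2, h3, h4] with y h2 h3 h4
      rw [hw (h2.2 h4), hq _ (h3 h4.le)]
    rw [gradient, gradient, this.fderiv_eq]
  filter_upwards [h.eventually_inner_neg, (tendsto_sub_smul s n).eventually hev] with ε h1 h2
  exact (h2 h1).symm

/-- The local description of `Ω` at `s` persists at the nearby points of the same hyperplane. -/
theorem eventually (h : IsSide Ω K s n) :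
    ∀ᶠ s' in 𝓝 s, inner ℝ (s' - s) n = 0 → IsSide Ω K s' n := by
  filter_upwards [h.outer.2.eventually_nhds, h.hull.eventually_nhds] with s' h1 h2 h0
  have heq : ∀ x, inner ℝ (x - s') n = inner ℝ (x - s) n := by
    intro x
    rw [← sub_add_sub_cancel x s' s, inner_add_left, h0, add_zero]
  refine ⟨⟨h.outer.1, ?_⟩, ?_⟩
  · filter_upwards [h1] with x hx
    rwa [heq]
  · filter_upwards [h2] with x hx
    rwa [heq]

end IsSide

variable {T : Geometry.SimplicialComplex ℝ (E d)} {K : Finset (E d)}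

/-- Near a point of a single facet hyperplane, a simplex is a half-space or a neighbourhood. -/
theorem mem_nhds_or_eventually_mem_hull_iff (hd : 1 ≤ d) (hK : K ∈ cells T)
    (hinteg : (interior (hull K)).Nonempty) {x n : E d} (hx : x ∈ hull K)
    (hn : ∀ c ∈ facets K, inner ℝ c.1 x = c.2 → c.1 = n ∨ c.1 = -n) :
    hull K ∈ 𝓝 x ∨ ∃ m, (m = n ∨ m = -n) ∧ ∀ᶠ y in 𝓝 x, y ∈ hull K ↔ inner ℝ (y - x) m ≤ 0 := by
  by_cases hnhds : hull K ∈ 𝓝 x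
  · exact Or.inl hnhds
  right
  obtain ⟨c, hc, hcx⟩ := exists_facet_of_notMem_interior hd hK hx
    (fun h => hnhds (mem_interior_iff_mem_nhds.1 h))
  -- Inequalities of facets not through `x` are strict there and persist nearby, so only the active
  -- facets matter.
  have hloc : ∀ᶠ y in 𝓝 x, y ∈ hull K ↔
      ∀ c ∈ facets K, inner ℝ c.1 x = c.2 → 0 ≤ inner ℝ c.1 (y - x) := by
    have h1 : ∀ᶠ y in 𝓝 x, ∀ c ∈ facets K, inner ℝ c.1 x ≠ c.2 → c.2 ≤ inner ℝ c.1 y := by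
      rw [Filter.eventually_all_finset]
      intro c hc
      by_cases hcx : inner ℝ c.1 x = c.2
      · simp [hcx]
      · have hlt := lt_of_le_of_ne ((mem_hull_iff hd hK).1 hx c hc) (Ne.symm hcx)
        filter_upwards [(continuous_const.inner continuous_id).continuousAt.eventually_const_lt hlt]
          with y hy _ using hy.le
    filter_upwards [h1] with y hy
    rw [mem_hull_iff hd hK]
    refine forall₂_congr fun c hc => ?_
    by_cases hcx : inner ℝ c.1 x = c.2
    · simp [inner_sub_right, hcx]
    · simp [hcx, hy c hc hcx]
  -- Two active facets with opposite normals would squeeze the simplex into a hyperplane, contrary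
  -- to its having interior points.
  have hsame : ∀ c' ∈ facets K, inner ℝ c'.1 x = c'.2 → c'.1 = c.1 := by
    intro c' hc' hcx'
    by_contra hne
    have hneg : c'.1 = -c.1 := by
      rcases hn c hc hcx with h | h <;> rcases hn c' hc' hcx' with h' | h'
      · exact absurd (h'.trans h.symm) hne
      · rw [h, h']
      · rw [h, h', neg_neg]
      · exact absurd (h'.trans h.symm) hne
    have hplane : ∀ y ∈ hull K, inner ℝ c.1 y = c.2 := by
      intro y hy
      have h1 := (mem_hull_iff hd hK).1 hy c hc
      have h2 := (mem_hull_iff hd hK).1 hy c' hc'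
      rw [← hcx', hneg, inner_neg_left, inner_neg_left, hcx] at h2
      linarith
    obtain ⟨z, hz⟩ := hinteg
    obtain ⟨ε, hε, hε0⟩ := (((tendsto_add_smul_nhdsGT z c.1).eventually
      (mem_interior_iff_mem_nhds.1 hz)).and self_mem_nhdsWithin).exists
    have hε0 : 0 < ε := hε0
    have h3 := hplane _ hε
    rw [inner_add_right, hplane z (interior_subset hz), inner_smul_right,
      real_inner_self_eq_norm_sq, (facets_spec hd hK).2.1 c hc] at h3
    linarith
  refine ⟨-c.1, ?_, ?_⟩
  · rcases hn c hc hcx with h | h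
    · right; rw [h]
    · left; rw [h, neg_neg]
  · filter_upwards [hloc] with y hy
    rw [hy, inner_neg_right, neg_nonpos, real_inner_comm]
    constructor
    · exact fun h => h c hc hcx
    · intro h c' hc' hcx'
      rwa [hsame c' hc' hcx']

end local_structure

/-! ### The common scale and the local structure of the interface. -/

namespace OverlappingMeshes

variable {d : ℕ} {σ κ : ℝ} (M : OverlappingMeshes d σ κ)

theorem isOpen_Ω1 (t : ℝ) : IsOpen (M.Ω1 t) := by
  rw [Ω1, ← closure_eq_self_union_frontier]
  exact M.polygonal_Ω0.isOpen.sdiff isClosed_closure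

theorem Ω2_eq {t : ℝ} (ht : t ∈ Icc 0 M.T) : M.Ω2 t = M.G t :=
  inter_eq_right.2 (M.G_subset t ht)

theorem mem_Ω1_iff {t : ℝ} {x : E d} : x ∈ M.Ω1 t ↔ x ∈ M.Ω0 ∧ x ∉ closure (M.G t) := by
  rw [Ω1, ← closure_eq_self_union_frontier]
  rfl

theorem isOpen_Ω2 {t : ℝ} (ht : t ∈ Icc 0 M.T) : IsOpen (M.Ω2 t) := by
  rw [M.Ω2_eq ht]
  exact (M.polygonal_G t ht).isOpen

/-- The cells of the two meshes. -/
def allCells (t : ℝ) : Set (Finset (E d)) := cells M.T0 ∪ cells (M.TG t)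

theorem finite_allCells {t : ℝ} (ht : t ∈ Icc 0 M.T) : (M.allCells t).Finite :=
  M.mesh_T0.1.union (M.mesh_TG t ht).1

/-- All cells of the two meshes are of comparable size. -/
theorem exists_scale {t : ℝ} (ht : t ∈ Icc 0 M.T) :
    0 < κ ∧ 0 < σ ∧ ∃ k : ℝ, 0 < k ∧ ∀ s ∈ M.allCells t, IsCellAtScale κ (κ * σ)⁻¹ k s := by
  have hN : 0 < M.N := by
    rcases Nat.eq_zero_or_pos M.N with h | h
    · have h1 := M.tn_last
      rw [h, M.tn_zero] at h1
      exact absurd h1 M.T_pos.ne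
    · exact h
  -- Every cell is comparable to every time step, so the first step can serve as the scale.
  have hk : 0 < M.tn (0 + 1) - M.tn 0 := sub_pos.2 (M.tn_lt 0 hN)
  have hsz := M.quasiUniform_spaceTime 0 hN t ht
  set k := M.tn (0 + 1) - M.tn 0
  have hKnn : ∀ s : Finset (E d), 0 ≤ hK s := fun s => Metric.diam_nonneg
  have hpos : ∀ s ∈ M.allCells t, 0 < κ ∧ 0 < hK s := by
    intro s hs
    have h1 := (hsz s hs).2
    have h2 : 0 < κ * hK s := hk.trans_le h1
    have h3 : 0 < hK s := lt_of_le_of_ne (hKnn s) fun h => by simp [← h] at h2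
    exact ⟨pos_of_mul_pos_left h2 h3.le, h3⟩
  have hqu : ∀ s ∈ M.allCells t, ∃ (x : E d) (r : ℝ), 0 < r ∧
      Metric.closedBall x r ⊆ hull s ∧ hK s ≤ σ * r := by
    rintro s (hs | hs)
    · obtain ⟨x, r, hr, hx, h⟩ := M.quasiUniform_T0 s hs
      exact ⟨x, r, hr, hx, h s hs⟩
    · obtain ⟨x, r, hr, hx, h⟩ := M.quasiUniform_TG t ht s hs
      exact ⟨x, r, hr, hx, h s hs⟩
  obtain ⟨s₀, hs₀⟩ : ∃ s, s ∈ cells M.T0 := by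
    obtain ⟨x, hx⟩ := M.polygonal_Ω0.isConnected.nonempty
    have h1 := subset_closure hx
    rw [← M.mesh_T0.2] at h1
    obtain ⟨s, hs, -⟩ := mem_iUnion₂.1 h1
    exact ⟨s, hs⟩
  have hs₀ : s₀ ∈ M.allCells t := Or.inl hs₀
  have hκ := (hpos s₀ hs₀).1
  have hσ : 0 < σ := by
    obtain ⟨x, r, hr, -, h⟩ := hqu s₀ hs₀
    exact pos_of_mul_pos_left ((hpos s₀ hs₀).2.trans_le h) hr.le
  refine ⟨hκ, hσ, k, hk, fun s hs => ⟨(hsz s hs).1, (hsz s hs).2, ?_⟩⟩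
  obtain ⟨x, r, hr, hx, h⟩ := hqu s hs
  refine ⟨x, ?_, fun y hy => ?_⟩
  -- With `r` the inradius from quasi-uniformity, `k ≤ κ h_K ≤ κ σ r`, so a ball of radius `k / (κ
  -- σ)` fits.
  · refine interior_maximal ((Metric.ball_subset_closedBall.trans
      (Metric.closedBall_subset_closedBall ?_)).trans hx) Metric.isOpen_ball
    rw [inv_mul_le_iff₀ (by positivity), mul_assoc]
    exact (hsz s hs).2.trans (by gcongr)
  · rw [Metric.mem_closedBall]
    refine (Metric.dist_le_diam_of_mem (isCompact_hull s).isBounded hy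
      (hx (Metric.mem_closedBall_self hr.le))).trans (hsz s hs).1

/-- The points which lie on two non-parallel facet hyperplanes of the cells. -/
def badSet (t : ℝ) : Set (E d) :=
  ⋃ s ∈ M.allCells t, ⋃ s' ∈ M.allCells t, ⋃ c ∈ facets s, ⋃ c' ∈ facets s',
    {x | (c'.1 ≠ c.1 ∧ c'.1 ≠ -c.1) ∧ inner ℝ c.1 x = c.2 ∧ inner ℝ c'.1 x = c'.2}

theorem mem_cells_of_mem_allCells {t : ℝ} {s : Finset (E d)} (hs : s ∈ M.allCells t) :
    ∃ T : Geometry.SimplicialComplex ℝ (E d), s ∈ cells T :=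
  hs.elim (fun h => ⟨_, h⟩) (fun h => ⟨_, h⟩)

theorem measurableSet_badSet {t : ℝ} (ht : t ∈ Icc 0 M.T) : MeasurableSet (M.badSet t) := by
  refine (M.finite_allCells ht).measurableSet_biUnion fun s _ =>
    (M.finite_allCells ht).measurableSet_biUnion fun s' _ =>
    Finset.measurableSet_biUnion _ fun c _ => Finset.measurableSet_biUnion _ fun c' _ => ?_
  refine (MeasurableSet.const _).inter (MeasurableSet.inter ?_ ?_)
  · exact measurableSet_eq_fun (by fun_prop) (by fun_prop)
  · exact measurableSet_eq_fun (by fun_prop) (by fun_prop)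

theorem hausdorff_badSet (hd : 1 ≤ d) {t : ℝ} (ht : t ∈ Icc 0 M.T) :
    Measure.euclideanHausdorffMeasure (d - 1) (M.badSet t) = 0 := by
  refine (measure_biUnion_null_iff (M.finite_allCells ht).countable).2 fun s hs =>
    (measure_biUnion_null_iff (M.finite_allCells ht).countable).2 fun s' hs' =>
    (measure_biUnion_null_iff (Finset.countable_toSet _)).2 fun c hc =>
    (measure_biUnion_null_iff (Finset.countable_toSet _)).2 fun c' hc' => ?_
  obtain ⟨T, hT⟩ := M.mem_cells_of_mem_allCells hs
  obtain ⟨T', hT'⟩ := M.mem_cells_of_mem_allCells hs'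
  by_cases h : c'.1 ≠ c.1 ∧ c'.1 ≠ -c.1
  · refine measure_mono_null (fun x hx => hx.2) (hausdorff_inter_hyperplanes_eq_zero
      ((facets_spec hd hT).2.1 c hc) ((facets_spec hd hT').2.1 c' hc') h.1 h.2 c.2 c'.2)
  · refine measure_mono_null (t := ∅) (fun x hx => h hx.1) measure_empty

theorem parallel_of_notMem_badSet {t : ℝ} {x : E d} (hx : x ∉ M.badSet t) {s s' : Finset (E d)}
    (hs : s ∈ M.allCells t) (hs' : s' ∈ M.allCells t) {c c' : E d × ℝ} (hc : c ∈ facets s)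
    (hc' : c' ∈ facets s') (hcx : inner ℝ c.1 x = c.2) (hcx' : inner ℝ c'.1 x = c'.2) :
    c'.1 = c.1 ∨ c'.1 = -c.1 := by
  by_contra! h
  refine hx ?_
  simp only [badSet, mem_iUnion]
  exact ⟨s, hs, s', hs', c, hc, c', hc', h, hcx, hcx'⟩

/-- Since `G` is the interior of its closure, interior points of its cells belong to `G`. Without
this, cells could cover both sides of a slit. -/
theorem notMem_interior_hull_of_mem_frontier {t : ℝ} (ht : t ∈ Icc 0 M.T) {x : E d}
    (hx : x ∈ frontier (M.G t)) {s : Finset (E d)} (hs : s ∈ cells (M.TG t)) :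
    x ∉ interior (hull s) := by
  intro h
  rw [(M.polygonal_G t ht).isOpen.frontier_eq] at hx
  refine hx.2 ?_
  rw [← (M.polygonal_G t ht).interior_closure]
  refine interior_mono ?_ h
  rw [← (M.mesh_TG t ht).2]
  exact subset_biUnion_of_mem (u := hull) hs

theorem exists_cell_of_mem_closure {t : ℝ} (ht : t ∈ Icc 0 M.T) {x : E d}
    (hx : x ∈ closure (M.G t)) : ∃ s ∈ cells (M.TG t), x ∈ hull s := by
  rw [← (M.mesh_TG t ht).2] at hx
  simpa using hx

theorem Γ_subset_frontier {t : ℝ} (ht : t ∈ Icc 0 M.T) : M.Γ t ⊆ frontier (M.G t) := by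
  intro x hx
  have := hx.2
  rwa [M.Ω2_eq ht] at this

/-- Near every point of the interface off the bad set, `G` is a half-space, bounded by a facet
hyperplane, and is covered by a cell. -/
theorem exists_isSide_G (hd : 1 ≤ d) {t : ℝ} (ht : t ∈ Icc 0 M.T) {s : E d}
    (hs : s ∈ frontier (M.G t)) (hbad : s ∉ M.badSet t) :
    ∃ m, ∃ K ∈ cells (M.TG t), IsSide (M.G t) K s m ∧
      (∀ᶠ x in 𝓝 s, x ∈ closure (M.G t) ↔ inner ℝ (x - s) m ≤ 0) ∧
      ∀ s' ∈ M.allCells t, ∀ c ∈ facets s', inner ℝ c.1 s = c.2 → c.1 = m ∨ c.1 = -m := by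
  obtain ⟨-, -, k, hk, hcell⟩ := M.exists_scale ht
  have hinteg : ∀ K ∈ M.allCells t, (interior (hull K)).Nonempty := by
    intro K hK
    obtain ⟨hκ, hσ, -⟩ := M.exists_scale ht
    obtain ⟨x, hx, -⟩ := (hcell K hK).exists_ball
    exact ⟨x, hx (Metric.mem_ball_self (by positivity))⟩
  obtain ⟨K, hK, hsK⟩ := M.exists_cell_of_mem_closure ht (frontier_subset_closure hs)
  have hG := M.polygonal_G t ht
  have hnot : ∀ K ∈ cells (M.TG t), hull K ∉ 𝓝 s := fun K hK h =>
    M.notMem_interior_hull_of_mem_frontier ht hs hK (mem_interior_iff_mem_nhds.2 h)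
  obtain ⟨c, hc, hcs⟩ := exists_facet_of_notMem_interior hd hK hsK
    (M.notMem_interior_hull_of_mem_frontier ht hs hK)
  have hpar : ∀ s' ∈ M.allCells t, ∀ c' ∈ facets s', inner ℝ c'.1 s = c'.2 →
      c'.1 = c.1 ∨ c'.1 = -c.1 := fun s' hs' c' hc' hcs' =>
    M.parallel_of_notMem_badSet hbad (Or.inr hK) hs' hc hc' hcs hcs'
  obtain ⟨m, hm, hKm⟩ := (mem_nhds_or_eventually_mem_hull_iff hd hK (hinteg K (Or.inr hK)) hsK
    (hpar K (Or.inr hK))).resolve_left (hnot K hK)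
  have hm1 : ‖m‖ = 1 := by
    have := (facets_spec hd hK).2.1 c hc
    rcases hm with rfl | rfl <;> simpa
  have hpar' : ∀ s' ∈ M.allCells t, ∀ c' ∈ facets s', inner ℝ c'.1 s = c'.2 →
      c'.1 = m ∨ c'.1 = -m := by
    intro s' hs' c' hc' hcs'
    rcases hm with rfl | rfl
    · exact hpar s' hs' c' hc' hcs'
    · rw [neg_neg]
      exact (hpar s' hs' c' hc' hcs').symm
  have hsG : s ∉ M.G t := by
    rw [hG.isOpen.frontier_eq] at hs
    exact hs.2
  -- A cell at `s` on the side opposite to `K` would, together with `K`, cover a neighbourhood of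
  -- `s`. Then `s` would lie in the interior of the closure of `G`, that is, in `G`.
  have hother : ∀ᶠ x in 𝓝 s, ∀ K' ∈ cells (M.TG t), x ∈ hull K' → inner ℝ (x - s) m ≤ 0 := by
    rw [Filter.eventually_all_finite (M.mesh_TG t ht).1]
    intro K' hK'
    by_cases hsK' : s ∈ hull K'
    · obtain ⟨m', hm', hKm'⟩ := (mem_nhds_or_eventually_mem_hull_iff hd hK' (hinteg K' (Or.inr hK'))
        hsK' (hpar' K' (Or.inr hK'))).resolve_left (hnot K' hK')
      rcases hm' with rfl | rfl
      · filter_upwards [hKm'] with x hx using hx.1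
      · exfalso
        refine hsG ?_
        rw [← hG.interior_closure, mem_interior_iff_mem_nhds, ← (M.mesh_TG t ht).2]
        filter_upwards [hKm, hKm'] with x hx hx'
        rw [inner_neg_right, neg_nonpos] at hx'
        rcases le_total (inner ℝ (x - s) m) 0 with h | h
        · exact mem_biUnion hK (hx.2 h)
        · exact mem_biUnion hK' (hx'.2 h)
    · filter_upwards [(isClosed_hull K').isOpen_compl.mem_nhds hsK'] with x hx hx'
      exact absurd hx' hx
  have hcl : ∀ᶠ x in 𝓝 s, x ∈ closure (M.G t) ↔ inner ℝ (x - s) m ≤ 0 := by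
    filter_upwards [hother, hKm] with x h1 h2
    constructor
    · intro hx
      obtain ⟨K', hK', hxK'⟩ := M.exists_cell_of_mem_closure ht hx
      exact h1 K' hK' hxK'
    · intro hx
      rw [← (M.mesh_TG t ht).2]
      exact mem_biUnion hK (h2.2 hx)
  refine ⟨m, K, hK, ⟨⟨hm1, ?_⟩, ?_⟩, hcl, hpar'⟩
  -- `G` is recovered as the interior of its closure, locally a closed half-space; a boundary point
  -- is excluded by moving it along `m`.
  · filter_upwards [hcl.eventually_nhds] with x hx
    rw [← hG.interior_closure, mem_interior_iff_mem_nhds]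
    constructor
    · intro h
      obtain ⟨ε, ⟨h1, h2⟩, hε0⟩ := (((tendsto_add_smul_nhdsGT x m).eventually (hx.and h)).and
        self_mem_nhdsWithin).exists
      have hε0 : 0 < ε := hε0
      have h3 := h1.1 h2
      rw [add_sub_right_comm, inner_add_left, inner_smul_left, real_inner_self_eq_norm_sq,
        hm1] at h3
      simp only [conj_trivial] at h3
      linarith
    · intro h
      filter_upwards [hx, (continuous_inner_sub s m).continuousAt.eventually_lt_const h]
        with y hy hy' using hy.2 hy'.le
  · filter_upwards [hKm] with x hx using hx.2

/-- The structure of the interface at its points off the bad set: it is flat there, and each of the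
two sides is covered by a single cell. -/
theorem exists_isSide (hd : 1 ≤ d) {t : ℝ} (ht : t ∈ Icc 0 M.T) {s : E d}
    (hs : s ∈ M.Γ t) (hbad : s ∉ M.badSet t) :
    ∃ n, ∃ K₁ ∈ cells M.T0, ∃ K₂ ∈ cells (M.TG t),
      IsSide (M.Ω1 t) K₁ s n ∧ IsSide (M.Ω2 t) K₂ s (-n) := by
  obtain ⟨hκ, hσ, k, hk, hcell⟩ := M.exists_scale ht
  obtain ⟨m, K₂, hK₂, hside, hcl, hpar⟩ :=
    M.exists_isSide_G hd ht (M.Γ_subset_frontier ht hs) hbad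
  have hs1 : ∃ᶠ x in 𝓝 s, x ∈ M.Ω1 t :=
    mem_closure_iff_frequently.1 (frontier_subset_closure hs.1)
  -- Convexity of `Ω0` enters here. If `s` were outside, a separating functional would be negative
  -- on the half-space filled by `G`, hence positive on the opposite one. Points of `Ω1` accumulate
  -- at `s` from that opposite side, although they lie in `Ω0`.
  have hsΩ0 : s ∈ M.Ω0 := by
    by_contra hns
    obtain ⟨f, hf⟩ := geometric_hahn_banach_open_point M.convex_Ω0 M.polygonal_Ω0.isOpen hns
    have h1 : ∀ᶠ x in 𝓝 s, inner ℝ (x - s) m < 0 → f (x - s) < 0 := by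
      filter_upwards [hside.outer.2] with x hx hxm
      rw [map_sub, sub_neg]
      exact hf x (M.G_subset t ht (hx.2 hxm))
    obtain ⟨y, hy, hycl⟩ := (hs1.and_eventually hcl).exists
    rw [M.mem_Ω1_iff] at hy
    have hpos : 0 < inner ℝ (y - s) m := not_le.1 fun h => hy.2 (hycl.2 h)
    have h2 := inner_neg_of_eventually h1 (u := s - y) (by
      rw [← neg_sub, inner_neg_left]
      linarith)
    rw [map_sub] at h2
    have := hf y hy.1
    linarith
  have hΩ0 := M.polygonal_Ω0.isOpen.mem_nhds hsΩ0
  have hinteg : ∀ K ∈ M.allCells t, (interior (hull K)).Nonempty := by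
    intro K hK
    obtain ⟨x, hx, -⟩ := (hcell K hK).exists_ball
    exact ⟨x, hx (Metric.mem_ball_self (by positivity))⟩
  -- Each background cell at `s` is a neighbourhood or one of the two half-spaces. If all were
  -- confined to the side of `G`, the points `s + ε m` of `Ω0` would be left uncovered.
  obtain ⟨K₁, hK₁, hK₁m⟩ : ∃ K₁ ∈ cells M.T0,
      ∀ᶠ x in 𝓝 s, 0 ≤ inner ℝ (x - s) m → x ∈ hull K₁ := by
    by_contra hno
    have hall : ∀ᶠ x in 𝓝 s, ∀ K ∈ cells M.T0, x ∈ hull K → inner ℝ (x - s) m ≤ 0 := by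
      rw [Filter.eventually_all_finite M.mesh_T0.1]
      intro K hK
      by_cases hsK : s ∈ hull K
      · rcases mem_nhds_or_eventually_mem_hull_iff hd hK (hinteg K (Or.inl hK)) hsK
          (hpar K (Or.inl hK)) with h | ⟨m', rfl | rfl, hm'⟩
        · exact absurd ⟨K, hK, by filter_upwards [h] with x hx _ using hx⟩ hno
        · filter_upwards [hm'] with x hx using hx.1
        · refine absurd ⟨K, hK, ?_⟩ hno
          filter_upwards [hm'] with x hx hx'
          exact hx.2 (by rw [inner_neg_right]; linarith)
      · filter_upwards [(isClosed_hull K).isOpen_compl.mem_nhds hsK] with x hx hx'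
        exact absurd hx' hx
    obtain ⟨ε, ⟨h1, h2⟩, hε0⟩ := (((tendsto_add_smul_nhdsGT s m).eventually (hall.and hΩ0)).and
      self_mem_nhdsWithin).exists
    have hε0 : 0 < ε := hε0
    have h3 := subset_closure h2
    rw [← M.mesh_T0.2] at h3
    obtain ⟨K, hK, hxK⟩ := mem_iUnion₂.1 h3
    have h4 := h1 K hK hxK
    rw [add_sub_cancel_left, inner_smul_left, real_inner_self_eq_norm_sq, hside.outer.1] at h4
    simp only [conj_trivial] at h4
    linarith
  refine ⟨-m, K₁, hK₁, K₂, hK₂, ⟨⟨by rw [norm_neg, hside.outer.1], ?_⟩, ?_⟩, ?_⟩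
  · filter_upwards [hcl, hΩ0] with x hx hx0
    rw [M.mem_Ω1_iff, hx, inner_neg_right, neg_lt_zero, not_le]
    exact and_iff_right hx0
  · filter_upwards [hK₁m] with x hx hx'
    rw [inner_neg_right] at hx'
    exact hx (by linarith)
  · rwa [neg_neg, M.Ω2_eq ht]

end OverlappingMeshes

/-! ### Energies of piecewise polynomials on cells. -/

theorem measurable_gradient {d : ℕ} (f : E d → ℝ) : Measurable (gradient f) :=
  (InnerProductSpace.toDual ℝ (E d)).symm.continuous.measurable.comp (measurable_fderiv ℝ f)

theorem volume_frontier_hull {d : ℕ} (s : Finset (E d)) : volume (frontier (hull s)) = 0 :=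
  (convex_convexHull ℝ _).addHaar_frontier volume

section piecewise

variable {d : ℕ} {T : Geometry.SimplicialComplex ℝ (E d)} {v : E d → ℝ}

theorem gradient_eq_polyGrad {s : Finset (E d)} {q : MvPolynomial (Fin d) ℝ}
    (hq : ∀ x ∈ hull s, v x = polyFn q x) {x : E d} (hx : x ∈ interior (hull s)) :
    gradient v x = polyGrad q x := by
  have : v =ᶠ[𝓝 x] polyFn q := by
    filter_upwards [mem_interior_iff_mem_nhds.1 hx] with y hy using hq y hy
  rw [← gradient_polyFn, gradient, gradient, this.fderiv_eq]

theorem integrableOn_polyGrad_sq (q : MvPolynomial (Fin d) ℝ) {A : Set (E d)}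
    (hA : Bornology.IsBounded A) : IntegrableOn (fun x => ‖polyGrad q x‖ ^ 2) A :=
  (((continuous_polyGrad q).norm.pow 2).continuousOn.integrableOn_compact
    hA.isCompact_closure).mono_set subset_closure

theorem integrableOn_gradient_sq_interior {p : ℕ} (hv : IsPiecewisePoly p T v) {s : Finset (E d)}
    (hs : s ∈ cells T) : IntegrableOn (fun x => ‖gradient v x‖ ^ 2) (interior (hull s)) := by
  obtain ⟨q, -, hq⟩ := hv s hs
  refine (integrableOn_polyGrad_sq q
    ((isCompact_hull s).isBounded.subset interior_subset)).congr_fun (fun x hx => ?_)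
    isOpen_interior.measurableSet
  simp only [gradient_eq_polyGrad hq hx]

/-- The gradient of a piecewise polynomial function is square integrable. -/
theorem integrableOn_gradient_sq {p : ℕ} (hv : IsPiecewisePoly p T v) {Ω : Set (E d)}
    (hT : IsMeshOf T Ω) : IntegrableOn (fun x => ‖gradient v x‖ ^ 2) Ω := by
  refine IntegrableOn.mono_set ?_ (subset_closure.trans_eq hT.2.symm)
  rw [integrableOn_finite_biUnion hT.1]
  intro s hs
  exact (integrableOn_gradient_sq_interior hv hs).congr_set_ae
    (interior_ae_eq_of_null_frontier (volume_frontier_hull s)).symm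

theorem sum_integral_gradient_sq {p : ℕ} (hv : IsPiecewisePoly p T v)
    (A : Finset (Finset (E d))) (hA : ∀ s ∈ A, s ∈ cells T) :
    ∑ s ∈ A, ∫ x in interior (hull s), ‖gradient v x‖ ^ 2 =
      ∫ x in ⋃ s ∈ A, interior (hull s), ‖gradient v x‖ ^ 2 := by
  rw [integral_biUnion_finset A (fun _ _ => isOpen_interior.measurableSet)
    (fun s hs s' hs' hne => disjoint_interior_hull (hA s hs) (hA s' hs') hne)
    (fun s hs => integrableOn_gradient_sq_interior hv (hA s hs))]

/-- The inverse estimate on a cell. -/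
theorem exists_polyGrad_sq_le_integral_cell (d p : ℕ) {κ ρ : ℝ} (hρ : 0 < ρ) :
    ∃ C : ℝ, 0 < C ∧ ∀ (k : ℝ), 0 < k → ∀ s : Finset (E d), IsCellAtScale κ ρ k s →
      ∀ (v : E d → ℝ) (q : MvPolynomial (Fin d) ℝ), q.totalDegree ≤ p →
      (∀ x ∈ hull s, v x = polyFn q x) → ∀ y ∈ hull s,
        ‖polyGrad q y‖ ^ 2 ≤ C * (k ^ d)⁻¹ * ∫ x in interior (hull s), ‖gradient v x‖ ^ 2 := by
  obtain ⟨C, hC, H⟩ := exists_polyGrad_sq_le_integral_ball d p (R := κ) hρ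
  refine ⟨C, hC, fun k hk s hs v q hq hv y hy => ?_⟩
  obtain ⟨x, hx, hx'⟩ := hs.exists_ball
  refine (H q hq x k hk y (hx' hy)).trans ?_
  have h1 : ∫ x in interior (hull s), ‖gradient v x‖ ^ 2 =
      ∫ x in interior (hull s), ‖polyGrad q x‖ ^ 2 :=
    setIntegral_congr_fun isOpen_interior.measurableSet fun x hx => by
      simp only [gradient_eq_polyGrad hv hx]
  rw [h1]
  refine mul_le_mul_of_nonneg_left ?_ (by positivity)
  exact setIntegral_mono_set (integrableOn_polyGrad_sq q
    ((isCompact_hull s).isBounded.subset interior_subset))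
    (Eventually.of_forall fun x => by positivity) hx.eventuallyLE

end piecewise

namespace OverlappingMeshes

variable {d : ℕ} {σ κ : ℝ} (M : OverlappingMeshes d σ κ)

/-- The frontier of `G` lies in the union of the frontiers of its cells, which are null because the
cells are convex. -/
theorem volume_frontier_G {t : ℝ} (ht : t ∈ Icc 0 M.T) : volume (frontier (M.G t)) = 0 := by
  refine measure_mono_null (t := ⋃ s ∈ cells (M.TG t), frontier (hull s)) (fun x hx => ?_)
    ((measure_biUnion_null_iff (M.mesh_TG t ht).1.countable).2 fun s _ => volume_frontier_hull s)
  obtain ⟨s, hs, hxs⟩ := M.exists_cell_of_mem_closure ht (frontier_subset_closure hx)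
  refine mem_biUnion hs ?_
  rw [(isClosed_hull s).frontier_eq]
  exact ⟨hxs, M.notMem_interior_hull_of_mem_frontier ht hx hs⟩

theorem finite_cutCells (t : ℝ) : (M.cutCells t).Finite :=
  M.mesh_T0.1.subset fun _ hs => hs.1

theorem interior_hull_subset_Ω0 {s : Finset (E d)} (hs : s ∈ cells M.T0) :
    interior (hull s) ⊆ M.Ω0 := by
  rw [← M.polygonal_Ω0.interior_closure, ← M.mesh_T0.2]
  exact interior_mono (subset_biUnion_of_mem (u := hull) hs)

theorem interior_hull_subset_Ω2 {t : ℝ} (ht : t ∈ Icc 0 M.T) {s : Finset (E d)}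
    (hs : s ∈ cells (M.TG t)) : interior (hull s) ⊆ M.Ω2 t := by
  rw [M.Ω2_eq ht, ← (M.polygonal_G t ht).interior_closure, ← (M.mesh_TG t ht).2]
  exact interior_mono (subset_biUnion_of_mem (u := hull) hs)

theorem measurableSet_ΩO {t : ℝ} (ht : t ∈ Icc 0 M.T) : MeasurableSet (M.ΩO t) :=
  (M.finite_cutCells t).measurableSet_biUnion fun s _ =>
    (isClosed_hull s).measurableSet.inter (M.isOpen_Ω2 ht).measurableSet

theorem ΩO_subset (t : ℝ) : M.ΩO t ⊆ M.Ω2 t := iUnion₂_subset fun _ _ => inter_subset_right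

theorem gradient_eqOn_of_isOpen {Ω : Set (E d)} (hΩ : IsOpen Ω) {w f : E d → ℝ}
    (h : EqOn w f Ω) : EqOn (gradient w) (gradient f) Ω := by
  intro x hx
  rw [gradient, gradient, (h.eventuallyEq_of_mem (hΩ.mem_nhds hx)).fderiv_eq]

variable {p : ℕ} {t : ℝ} {v : BrokenFn d}

theorem integral_Ω1_gradient_sq (hv : v ∈ M.Vh p t) :
    ∫ x in M.Ω1 t, ‖gradient v.val x‖ ^ 2 = ∫ x in M.Ω1 t, ‖gradient v.ext1 x‖ ^ 2 :=
  setIntegral_congr_fun (M.isOpen_Ω1 t).measurableSet fun x hx => by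
    simp only [gradient_eqOn_of_isOpen (M.isOpen_Ω1 t) hv.2.2.1 hx]

theorem integral_Ω2_gradient_sq (ht : t ∈ Icc 0 M.T) (hv : v ∈ M.Vh p t) :
    ∫ x in M.Ω2 t, ‖gradient v.val x‖ ^ 2 = ∫ x in M.Ω2 t, ‖gradient v.ext2 x‖ ^ 2 :=
  setIntegral_congr_fun (M.isOpen_Ω2 ht).measurableSet fun x hx => by
    simp only [gradient_eqOn_of_isOpen (M.isOpen_Ω2 ht) hv.2.2.2 hx]

theorem integrableOn_ext1 (hv : v ∈ M.Vh p t) :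
    IntegrableOn (fun x => ‖gradient v.ext1 x‖ ^ 2) M.Ω0 :=
  integrableOn_gradient_sq hv.1.2.1 M.mesh_T0

theorem integrableOn_ext2 (ht : t ∈ Icc 0 M.T) (hv : v ∈ M.Vh p t) :
    IntegrableOn (fun x => ‖gradient v.ext2 x‖ ^ 2) (M.Ω2 t) := by
  rw [M.Ω2_eq ht]
  exact integrableOn_gradient_sq hv.2.1.2 (M.mesh_TG t ht)

/-- The energy of the second component on the cells of the overlapping mesh. -/
theorem sum_integral_ext2_le (ht : t ∈ Icc 0 M.T) (hv : v ∈ M.Vh p t)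
    (A : Finset (Finset (E d))) (hA : ∀ s ∈ A, s ∈ cells (M.TG t)) :
    ∑ s ∈ A, ∫ x in interior (hull s), ‖gradient v.ext2 x‖ ^ 2 ≤
      ∫ x in M.Ω2 t, ‖gradient v.val x‖ ^ 2 := by
  rw [sum_integral_gradient_sq hv.2.1.2 A hA, M.integral_Ω2_gradient_sq ht hv]
  exact setIntegral_mono_set (M.integrableOn_ext2 ht hv) (Eventually.of_forall fun x => by positivity)
    (iUnion₂_subset fun s hs => M.interior_hull_subset_Ω2 ht (hA s hs)).eventuallyLE

theorem norm_sq_le_two_mul_add (a b : E d) : ‖a‖ ^ 2 ≤ 2 * ‖a - b‖ ^ 2 + 2 * ‖b‖ ^ 2 := by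
  have h1 : ‖a‖ ≤ ‖a - b‖ + ‖b‖ := by simpa using norm_add_le (a - b) b
  have h2 : ‖a‖ ^ 2 ≤ (‖a - b‖ + ‖b‖) ^ 2 := by gcongr
  nlinarith [sq_nonneg (‖a - b‖ - ‖b‖)]

/-- The energy of the first component on the cut cells is controlled by means of the stabilization
on the overlap region. -/
theorem sum_integral_ext1_le (ht : t ∈ Icc 0 M.T) (hv : v ∈ M.Vh p t)
    (A : Finset (Finset (E d))) (hA : ∀ s ∈ A, s ∈ M.cutCells t) :
    ∑ s ∈ A, ∫ x in interior (hull s), ‖gradient v.ext1 x‖ ^ 2 ≤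
      (∫ x in M.Ω1 t, ‖gradient v.val x‖ ^ 2) + 2 * (∫ x in M.Ω2 t, ‖gradient v.val x‖ ^ 2) +
        2 * ∫ x in M.ΩO t, ‖v.gradJump x‖ ^ 2 := by
  have hcellA : ∀ s ∈ A, s ∈ cells M.T0 := fun s hs => (hA s hs).1
  rw [sum_integral_gradient_sq hv.1.2.1 A hcellA, M.integral_Ω1_gradient_sq hv,
    M.integral_Ω2_gradient_sq ht hv]
  set U : Set (E d) := ⋃ s ∈ A, interior (hull s) with hU
  have hUΩ0 : U ⊆ M.Ω0 := iUnion₂_subset fun s hs => M.interior_hull_subset_Ω0 (hcellA s hs)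
  have hΩ2Ω0 : M.Ω2 t ⊆ M.Ω0 := inter_subset_left
  have hΩ1Ω0 : M.Ω1 t ⊆ M.Ω0 := sdiff_subset
  have hOm := M.measurableSet_ΩO ht
  have hO2 := M.ΩO_subset t
  have h0 := M.integrableOn_ext1 hv
  have h2 := M.integrableOn_ext2 ht hv
  have h0O : IntegrableOn (fun x => ‖gradient v.ext1 x‖ ^ 2) (M.ΩO t) :=
    h0.mono_set (hO2.trans hΩ2Ω0)
  have h2O := h2.mono_set hO2
  have hdisj : Disjoint (M.Ω1 t) (M.ΩO t) := by
    rw [Set.disjoint_left]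
    intro x hx hx'
    exact (M.mem_Ω1_iff.1 hx).2 (subset_closure (hO2 hx').2)
  have hjump : IntegrableOn (fun x => ‖v.gradJump x‖ ^ 2) (M.ΩO t) := by
    refine Integrable.mono' ((h0O.const_mul 2).add (h2O.const_mul 2))
      (((measurable_gradient _).sub (measurable_gradient _)).norm.pow_const 2).aestronglyMeasurable
      (Eventually.of_forall fun x => ?_)
    have := norm_sq_le_two_mul_add (v.gradJump x) (-gradient v.ext2 x)
    rw [BrokenFn.gradJump, sub_neg_eq_add, sub_add_cancel, norm_neg] at this
    rw [Real.norm_of_nonneg (by positivity)]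
    exact this
  -- Off the null set `∂G`, a point of a cut cell is either in `Ω1` or in the overlap region.
  have hsub : U ≤ᵐ[volume] (M.Ω1 t ∪ M.ΩO t : Set (E d)) := by
    have hnull : ∀ᵐ x, x ∉ frontier (M.G t) := measure_eq_zero_iff_ae_notMem.1
      (M.volume_frontier_G ht)
    filter_upwards [hnull] with x hx (hxU : x ∈ U)
    by_cases hxG : x ∈ M.G t
    · right
      obtain ⟨s, hs, hxs⟩ := mem_iUnion₂.1 hxU
      exact mem_biUnion (hA s hs) ⟨interior_subset hxs, hUΩ0 hxU, hxG⟩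
    · left
      exact ⟨hUΩ0 hxU, fun h => h.elim hxG hx⟩
  have hstep1 : ∫ x in U, ‖gradient v.ext1 x‖ ^ 2 ≤
      ∫ x in M.Ω1 t ∪ M.ΩO t, ‖gradient v.ext1 x‖ ^ 2 :=
    setIntegral_mono_set (h0.mono_set (union_subset hΩ1Ω0 (hO2.trans hΩ2Ω0)))
      (Eventually.of_forall fun x => by positivity) hsub
  rw [setIntegral_union hdisj hOm (h0.mono_set hΩ1Ω0) h0O] at hstep1
  -- On the overlap region the first gradient is the gradient jump plus the second gradient.
  have hstep2 : ∫ x in M.ΩO t, ‖gradient v.ext1 x‖ ^ 2 ≤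
      ∫ x in M.ΩO t, (2 * ‖v.gradJump x‖ ^ 2 + 2 * ‖gradient v.ext2 x‖ ^ 2) :=
    setIntegral_mono h0O ((hjump.const_mul 2).add (h2O.const_mul 2)) fun x =>
      norm_sq_le_two_mul_add _ _
  rw [integral_add (hjump.const_mul 2) (h2O.const_mul 2), integral_const_mul,
    integral_const_mul] at hstep2
  have hstep3 : ∫ x in M.ΩO t, ‖gradient v.ext2 x‖ ^ 2 ≤ ∫ x in M.Ω2 t, ‖gradient v.ext2 x‖ ^ 2 :=
    setIntegral_mono_set h2 (Eventually.of_forall fun x => by positivity) hO2.eventuallyLE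
  linarith

end OverlappingMeshes

/-! ### Integrals over the interface and the discrete trace inequality. -/

namespace OverlappingMeshes

variable {d : ℕ} {σ κ : ℝ} (M : OverlappingMeshes d σ κ) {ρ k : ℝ} {p : ℕ} {t : ℝ} {v : BrokenFn d}

theorem isClosed_Γ (t : ℝ) : IsClosed (M.Γ t) := isClosed_frontier.inter isClosed_frontier

theorem Γ_subset_closure_G (ht : t ∈ Icc 0 M.T) : M.Γ t ⊆ closure (M.G t) :=
  (M.Γ_subset_frontier ht).trans frontier_subset_closure

theorem Γ_subset_closure_Ω0 (ht : t ∈ Icc 0 M.T) : M.Γ t ⊆ closure M.Ω0 :=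
  (M.Γ_subset_closure_G ht).trans (closure_mono (M.G_subset t ht))

theorem isCompact_Γ (ht : t ∈ Icc 0 M.T) : IsCompact (M.Γ t) :=
  (M.polygonal_G t ht).isBounded.isCompact_closure.of_isClosed_subset (M.isClosed_Γ t)
    (M.Γ_subset_closure_G ht)

/-- The surface measure of the interface within a ball whose radius is comparable with the mesh
size. -/
theorem exists_hausdorff_Γ_inter_closedBall_le (hd : 1 ≤ d) (σ : ℝ) {κ ρ : ℝ} (hκ : 0 < κ)
    (hρ : 0 < ρ) : ∃ C : ℝ, 0 < C ∧ ∀ (M : OverlappingMeshes d σ κ) (t k : ℝ), t ∈ Icc 0 M.T →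
      0 < k → (∀ s ∈ M.allCells t, IsCellAtScale κ ρ k s) → ∀ y,
        Measure.euclideanHausdorffMeasure (d - 1) (Metric.closedBall y (κ * k) ∩ M.Γ t) ≤
          ENNReal.ofReal (C * k ^ (d - 1)) := by
  classical
  obtain ⟨C, hC, H⟩ := exists_hausdorff_hyperplane_inter_closedBall_le hd
  refine ⟨((κ + κ + ρ) / ρ) ^ d * ((d + 1) * (C * κ ^ (d - 1))), by positivity,
    fun M t k ht hk hcell y => ?_⟩
  let A : Finset (Finset (E d)) := (M.mesh_TG t ht).1.toFinset.filter fun s =>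
    (hull s ∩ Metric.closedBall y (κ * k)).Nonempty
  have hA : ∀ s ∈ A, s ∈ cells (M.TG t) ∧ (hull s ∩ Metric.closedBall y (κ * k)).Nonempty := by
    intro s hs
    simpa [A] using hs
  have hcard := card_cells_meeting_ball_le hκ hρ hk hκ.le hd y A fun s hs =>
    ⟨(hA s hs).1, hcell s (Or.inr (hA s hs).1), (hA s hs).2⟩
  -- A point of `Γ` lies in a cell of `TG` but not in its interior, hence on one of at most `d + 1`
  -- facet hyperplanes; the number of cells involved is bounded.
  have hsub : Metric.closedBall y (κ * k) ∩ M.Γ t ⊆ ⋃ s ∈ A, ⋃ c ∈ facets s,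
      ({x | inner ℝ c.1 x = c.2} ∩ Metric.closedBall y (κ * k)) := by
    rintro x ⟨hxy, hx⟩
    obtain ⟨s, hs, hxs⟩ := M.exists_cell_of_mem_closure ht (M.Γ_subset_closure_G ht hx)
    obtain ⟨c, hc, hcx⟩ := exists_facet_of_notMem_interior hd hs hxs
      (M.notMem_interior_hull_of_mem_frontier ht (M.Γ_subset_frontier ht hx) hs)
    have hsA : s ∈ A := by
      simp only [A, Finset.mem_filter, Finite.mem_toFinset]
      exact ⟨hs, x, hxs, hxy⟩
    exact mem_biUnion hsA (mem_biUnion hc ⟨hcx, hxy⟩)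
  have hB : (0 : ℝ) ≤ C * (κ * k) ^ (d - 1) := by positivity
  calc Measure.euclideanHausdorffMeasure (d - 1) (Metric.closedBall y (κ * k) ∩ M.Γ t)
      ≤ ∑ s ∈ A, ∑ c ∈ facets s, Measure.euclideanHausdorffMeasure (d - 1)
          ({x | inner ℝ c.1 x = c.2} ∩ Metric.closedBall y (κ * k)) :=
        (measure_mono hsub).trans ((measure_biUnion_finset_le _ _).trans
          (Finset.sum_le_sum fun s _ => measure_biUnion_finset_le _ _))
    _ ≤ ∑ s ∈ A, ∑ c ∈ facets s, ENNReal.ofReal (C * (κ * k) ^ (d - 1)) :=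
        Finset.sum_le_sum fun s hs => Finset.sum_le_sum fun c hc =>
          H c.1 c.2 ((facets_spec hd (hA s hs).1).2.1 c hc) y _ (by positivity)
    _ = ENNReal.ofReal (∑ s ∈ A, ∑ c ∈ facets s, C * (κ * k) ^ (d - 1)) := by
        rw [ENNReal.ofReal_sum_of_nonneg fun s _ => Finset.sum_nonneg fun c _ => hB]
        exact Finset.sum_congr rfl fun s _ => (ENNReal.ofReal_sum_of_nonneg fun c _ => hB).symm
    _ ≤ ENNReal.ofReal (((κ + κ + ρ) / ρ) ^ d * ((d + 1) * (C * κ ^ (d - 1))) * k ^ (d - 1)) := by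
        refine ENNReal.ofReal_le_ofReal ?_
        calc ∑ s ∈ A, ∑ c ∈ facets s, C * (κ * k) ^ (d - 1)
            ≤ ∑ s ∈ A, ((d + 1 : ℕ) : ℝ) * (C * (κ * k) ^ (d - 1)) := by
              refine Finset.sum_le_sum fun s hs => ?_
              rw [Finset.sum_const, nsmul_eq_mul]
              refine mul_le_mul_of_nonneg_right ?_ hB
              exact_mod_cast (facets_spec hd (hA s hs).1).1
          _ = A.card * (((d + 1 : ℕ) : ℝ) * (C * (κ * k) ^ (d - 1))) := by
              rw [Finset.sum_const, nsmul_eq_mul]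
          _ ≤ ((κ + κ + ρ) / ρ) ^ d * (((d + 1 : ℕ) : ℝ) * (C * (κ * k) ^ (d - 1))) := by
              gcongr
          _ = _ := by
              push_cast
              rw [mul_pow]
              ring

theorem hausdorff_Γ_lt_top (hd : 1 ≤ d) (ht : t ∈ Icc 0 M.T) :
    Measure.euclideanHausdorffMeasure (d - 1) (M.Γ t) < ⊤ := by
  obtain ⟨hκ, hσ, k, hk, hcell⟩ := M.exists_scale ht
  obtain ⟨C, -, H⟩ := exists_hausdorff_Γ_inter_closedBall_le hd σ hκ
    (show 0 < (κ * σ)⁻¹ by positivity)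
  refine (measure_mono (t := ⋃ s ∈ cells (M.TG t), hull s ∩ M.Γ t) fun x hx => ?_).trans_lt
    (measure_biUnion_lt_top (M.mesh_TG t ht).1 fun s hs => ?_)
  · obtain ⟨s, hs, hxs⟩ := M.exists_cell_of_mem_closure ht (M.Γ_subset_closure_G ht hx)
    exact mem_biUnion hs ⟨hxs, hx⟩
  · obtain ⟨x, -, hx⟩ := (hcell s (Or.inr hs)).exists_ball
    exact (measure_mono (inter_subset_inter_left _ hx)).trans_lt
      ((H M t k ht hk hcell x).trans_lt ENNReal.ofReal_lt_top)

/-- The cells of the background mesh overlap boundedly on the interface. -/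
theorem sum_surfaceIntegral_cutCells_le (hd : 1 ≤ d) (hκ : 0 < κ) (hρ : 0 < ρ) (hk : 0 < k)
    (hcell : ∀ s ∈ M.allCells t, IsCellAtScale κ ρ k s) {f : E d → ℝ} (hf0 : ∀ x, 0 ≤ f x)
    (hf : IntegrableOn f (M.Γ t) (Measure.euclideanHausdorffMeasure (d - 1))) :
    ∑ s ∈ (M.finite_cutCells t).toFinset, surfaceIntegral (hull s ∩ M.Γ t) f ≤
      ((κ + ρ) / ρ) ^ d * surfaceIntegral (M.Γ t) f := by
  classical
  have h1 : ∀ s : Finset (E d), surfaceIntegral (hull s ∩ M.Γ t) f =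
      ∫ x in M.Γ t, (hull s).indicator f x ∂(Measure.euclideanHausdorffMeasure (d - 1)) := by
    intro s
    rw [surfaceIntegral, setIntegral_indicator (isClosed_hull s).measurableSet, inter_comm]
  simp only [h1]
  rw [← integral_finsetSum _ fun s _ => hf.indicator (isClosed_hull s).measurableSet,
    surfaceIntegral, ← integral_const_mul]
  refine integral_mono (integrable_finsetSum _ fun s _ =>
    hf.indicator (isClosed_hull s).measurableSet) (hf.const_mul _) fun x => ?_
  have h2 : ∀ s : Finset (E d), (hull s).indicator f x = if x ∈ hull s then f x else 0 :=
    fun s => Set.indicator_apply _ _ _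
  simp only [h2]
  rw [← Finset.sum_filter, Finset.sum_const, nsmul_eq_mul]
  refine mul_le_mul_of_nonneg_right ?_ (hf0 x)
  -- Cells containing `x` are those meeting the ball of radius `0` about it.
  have h3 := card_cells_meeting_ball_le (T := M.T0) hκ hρ hk le_rfl hd x
    ((M.finite_cutCells t).toFinset.filter fun s => x ∈ hull s) fun s hs => by
      simp only [Finset.mem_filter, Finite.mem_toFinset] at hs
      exact ⟨hs.1.1, hcell s (Or.inl hs.1.1), x, hs.2, by simp⟩
  rwa [zero_add] at h3

section meshSize

/-- The mesh size at `x` depends only on which of the finitely many closed cells contain `x`. -/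
theorem measurable_meshSize : Measurable M.meshSize := by
  have hfin : Finite (cells M.T0) := M.mesh_T0.1.to_subtype
  let F : E d → (cells M.T0 → Prop) := fun x s => x ∈ hull s.1
  have hF : Measurable F := measurable_pi_lambda _ fun s =>
    measurable_mem.2 (isClosed_hull s.1).measurableSet
  let g : (cells M.T0 → Prop) → ℝ := fun P => sSup (hK '' {s | ∃ h : s ∈ cells M.T0, P ⟨s, h⟩})
  have hg : Measurable g := measurable_of_countable g
  have : M.meshSize = g ∘ F := by
    ext x
    simp only [meshSize, Function.comp, g, F]
    congr 2
    ext s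
    exact ⟨fun h => ⟨h.1, h.2⟩, fun ⟨h1, h2⟩ => ⟨h1, h2⟩⟩
  rw [this]
  exact hg.comp hF

/-- `Γ` lies in the closure of `Ω0`, so some background cell contains `x` and the supremum is not
the default value `sSup ∅ = 0`. -/
theorem meshSize_bounds (ht : t ∈ Icc 0 M.T) (hκ : 0 < κ)
    (hcell : ∀ s ∈ M.allCells t, IsCellAtScale κ ρ k s) {x : E d} (hx : x ∈ M.Γ t) :
    M.meshSize x ≤ κ * k ∧ k ≤ κ * M.meshSize x := by
  have hx0 := M.Γ_subset_closure_Ω0 ht hx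
  rw [← M.mesh_T0.2] at hx0
  obtain ⟨s, hs, hxs⟩ := mem_iUnion₂.1 hx0
  have hne : (hK '' {s ∈ cells M.T0 | x ∈ hull s}).Nonempty := ⟨_, s, ⟨hs, hxs⟩, rfl⟩
  have hub : ∀ y ∈ hK '' {s ∈ cells M.T0 | x ∈ hull s}, y ≤ κ * k := by
    rintro _ ⟨s', hs', rfl⟩
    exact (hcell s' (Or.inl hs'.1)).hK_le
  refine ⟨csSup_le hne hub, (hcell s (Or.inl hs)).le_hK.trans ?_⟩
  exact mul_le_mul_of_nonneg_left (le_csSup ⟨_, hub⟩ ⟨s, ⟨hs, hxs⟩, rfl⟩) hκ.le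

end meshSize

/-- The jump and the average of the normal derivatives near the points of the interface off the bad
set. -/
theorem exists_eventually_jump_avg_eq (hd : 1 ≤ d) (ht : t ∈ Icc 0 M.T) (hv : v ∈ M.Vh p t)
    {q₁ q₂ : Finset (E d) → MvPolynomial (Fin d) ℝ}
    (hq₁ : ∀ s ∈ cells M.T0, ∀ x ∈ hull s, v.ext1 x = polyFn (q₁ s) x)
    (hq₂ : ∀ s ∈ cells (M.TG t), ∀ x ∈ hull s, v.ext2 x = polyFn (q₂ s) x) {s : E d}
    (hs : s ∈ M.Γ t) (hbad : s ∉ M.badSet t) :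
    ∃ n, ‖n‖ = 1 ∧ ∃ K₁ ∈ cells M.T0, s ∈ hull K₁ ∧ ∃ K₂ ∈ cells (M.TG t), s ∈ hull K₂ ∧
      ∀ᶠ s' in 𝓝[M.Γ t] s, M.jump t v s' = v.ext1 s' - v.ext2 s' ∧
        ∀ ω₁ ω₂, M.avgNormalDeriv ω₁ ω₂ t v s' =
          ω₁ * inner ℝ n (polyGrad (q₁ K₁) s') + ω₂ * inner ℝ n (polyGrad (q₂ K₂) s') := by
  obtain ⟨n, K₁, hK₁, K₂, hK₂, h1, h2⟩ := M.exists_isSide hd ht hs hbad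
  refine ⟨n, h1.outer.1, K₁, hK₁, h1.mem_hull, K₂, hK₂, h2.mem_hull, ?_⟩
  rw [eventually_nhdsWithin_iff]
  filter_upwards [h1.eventually, h2.eventually, h1.outer.2, h2.outer.2] with x hx1 hx2 ho1 ho2 hxΓ
  -- A nearby point of `Γ` lies in neither of the open sets `Ω1` and `Ω2`, which are complementary
  -- open half-spaces here, so it lies on their common hyperplane.
  have hn1 : x ∉ M.Ω1 t := by
    have := hxΓ.1
    rw [(M.isOpen_Ω1 t).frontier_eq] at this
    exact this.2
  have hn2 : x ∉ M.Ω2 t := by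
    have := hxΓ.2
    rw [(M.isOpen_Ω2 ht).frontier_eq] at this
    exact this.2
  rw [ho1, not_lt] at hn1
  rw [ho2, inner_neg_right, not_lt] at hn2
  have h0 : inner ℝ (x - s) n = 0 := by linarith
  have hs1 := hx1 h0
  have hs2 := hx2 (by rw [inner_neg_right, h0, neg_zero])
  have e1 : M.n1 t x = n := hs1.outer.outerNormal_eq
  have e2 : M.n2 t x = -n := hs2.outer.outerNormal_eq
  refine ⟨?_, fun ω₁ ω₂ => ?_⟩
  · rw [jump, e1, e2, hs1.sideLimit_eq hv.2.2.1 (hq₁ K₁ hK₁),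
      hs2.sideLimit_eq hv.2.2.2 (hq₂ K₂ hK₂)]
  · rw [avgNormalDeriv, e1, e2, hs1.sideLimit_gradient_eq hv.2.2.1 (hq₁ K₁ hK₁),
      hs2.sideLimit_gradient_eq hv.2.2.2 (hq₂ K₂ hK₂)]

theorem exists_pieces {T : Geometry.SimplicialComplex ℝ (E d)} {f : E d → ℝ}
    (hf : IsPiecewisePoly p T f) : ∃ q : Finset (E d) → MvPolynomial (Fin d) ℝ,
      (∀ s ∈ cells T, (q s).totalDegree ≤ p) ∧ ∀ s ∈ cells T, ∀ x ∈ hull s, f x = polyFn (q s) x := by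
  choose! q hq hq' using hf
  exact ⟨q, hq, hq'⟩

theorem ae_restrict_Γ_of_notMem_badSet (hd : 1 ≤ d) (ht : t ∈ Icc 0 M.T) {P : E d → Prop}
    (h : ∀ s ∈ M.Γ t, s ∉ M.badSet t → P s) :
    ∀ᵐ s ∂(Measure.euclideanHausdorffMeasure (d - 1)).restrict (M.Γ t), P s := by
  rw [ae_restrict_iff' (M.isClosed_Γ t).measurableSet]
  filter_upwards [measure_eq_zero_iff_ae_notMem.1 (M.hausdorff_badSet hd ht)] with s hs hsΓ
  exact h s hsΓ hs

theorem ae_jump_eq (hd : 1 ≤ d) (ht : t ∈ Icc 0 M.T) (hv : v ∈ M.Vh p t) :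
    ∀ᵐ s ∂(Measure.euclideanHausdorffMeasure (d - 1)).restrict (M.Γ t),
      M.jump t v s = v.ext1 s - v.ext2 s := by
  obtain ⟨q₁, -, hq₁⟩ := exists_pieces hv.1.2.1
  obtain ⟨q₂, -, hq₂⟩ := exists_pieces hv.2.1.2
  refine M.ae_restrict_Γ_of_notMem_badSet hd ht fun s hs hbad => ?_
  obtain ⟨n, -, K₁, -, -, K₂, -, -, h⟩ := M.exists_eventually_jump_avg_eq hd ht hv hq₁ hq₂ hs hbad
  exact (h.self_of_nhdsWithin hs).1

/-- The jump is a bounded measurable function on the interface. -/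
theorem memLp_jump (hd : 1 ≤ d) (ht : t ∈ Icc 0 M.T) (hv : v ∈ M.Vh p t) :
    MemLp (M.jump t v) 2 ((Measure.euclideanHausdorffMeasure (d - 1)).restrict (M.Γ t)) := by
  have hfin : IsFiniteMeasure ((Measure.euclideanHausdorffMeasure (d - 1)).restrict (M.Γ t)) :=
    isFiniteMeasure_restrict.2 (M.hausdorff_Γ_lt_top hd ht).ne
  have hcont : ContinuousOn (fun s => v.ext1 s - v.ext2 s) (M.Γ t) :=
    (hv.1.1.mono (M.Γ_subset_closure_Ω0 ht)).sub (hv.2.1.1.mono (M.Γ_subset_closure_G ht))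
  obtain ⟨B, hB⟩ := (M.isCompact_Γ ht).exists_bound_of_continuousOn hcont
  refine MemLp.ae_eq (f := fun s => v.ext1 s - v.ext2 s) ?_
    (MemLp.of_bound (hcont.aestronglyMeasurable (M.isClosed_Γ t).measurableSet) B ?_)
  · filter_upwards [M.ae_jump_eq hd ht hv] with s hs using hs.symm
  · exact (ae_restrict_iff' (M.isClosed_Γ t).measurableSet).2 (Eventually.of_forall hB)

/-- Off the null bad set the average is locally a fixed polynomial expression along `Γ`, hence
continuous there. -/
theorem aestronglyMeasurable_avgNormalDeriv (hd : 1 ≤ d) (ht : t ∈ Icc 0 M.T)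
    (hv : v ∈ M.Vh p t) (ω₁ ω₂ : ℝ) : AEStronglyMeasurable (M.avgNormalDeriv ω₁ ω₂ t v)
      ((Measure.euclideanHausdorffMeasure (d - 1)).restrict (M.Γ t)) := by
  obtain ⟨q₁, -, hq₁⟩ := exists_pieces hv.1.2.1
  obtain ⟨q₂, -, hq₂⟩ := exists_pieces hv.2.1.2
  have hmeas : MeasurableSet (M.Γ t \ M.badSet t) :=
    (M.isClosed_Γ t).measurableSet.diff (M.measurableSet_badSet ht)
  have hae : (M.Γ t \ M.badSet t : Set (E d)) =ᵐ[Measure.euclideanHausdorffMeasure (d - 1)]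
      M.Γ t := sdiff_null_ae_eq_self (M.hausdorff_badSet hd ht)
  rw [← Measure.restrict_congr_set hae]
  refine ContinuousOn.aestronglyMeasurable (fun s hs => ?_) hmeas
  obtain ⟨n, -, K₁, -, -, K₂, -, -, h⟩ :=
    M.exists_eventually_jump_avg_eq hd ht hv hq₁ hq₂ hs.1 hs.2
  refine ContinuousWithinAt.mono ?_ sdiff_subset
  have hcont : Continuous fun s' : E d => ω₁ * inner ℝ n (polyGrad (q₁ K₁) s') +
      ω₂ * inner ℝ n (polyGrad (q₂ K₂) s') :=
    (continuous_const.mul (continuous_const.inner (continuous_polyGrad _))).add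
      (continuous_const.mul (continuous_const.inner (continuous_polyGrad _)))
  refine hcont.continuousWithinAt.congr_of_eventuallyEq ?_ ((h.self_of_nhdsWithin hs.1).2 _ _)
  filter_upwards [h] with s' hs' using hs'.2 _ _

theorem weighted_sq_le {ω₁ ω₂ a b : ℝ} (h₁ : ω₁ ∈ Icc (0 : ℝ) 1) (h₂ : ω₂ ∈ Icc (0 : ℝ) 1)
    (h : ω₁ + ω₂ = 1) : (ω₁ * a + ω₂ * b) ^ 2 ≤ a ^ 2 + b ^ 2 := by
  have e : ω₂ = 1 - ω₁ := by linarith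
  subst e
  nlinarith [mul_nonneg (mul_nonneg h₁.1 h₂.1) (sq_nonneg (a - b)),
    mul_nonneg h₁.1 (sq_nonneg b), mul_nonneg h₂.1 (sq_nonneg a)]

/-- The discrete trace inequality: the averaged normal derivative on the interface is controlled
by the gradients and the stabilization on the overlap region. -/
theorem exists_integral_avgNormalDeriv_sq_le (hd : 1 ≤ d) (p : ℕ) (σ : ℝ) {κ ρ : ℝ} (hκ : 0 < κ)
    (hρ : 0 < ρ) : ∃ C : ℝ, 0 < C ∧ ∀ (M : OverlappingMeshes d σ κ) (t k : ℝ), t ∈ Icc 0 M.T →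
      0 < k → (∀ s ∈ M.allCells t, IsCellAtScale κ ρ k s) → ∀ ω₁ ω₂ : ℝ, ω₁ ∈ Icc (0 : ℝ) 1 →
      ω₂ ∈ Icc (0 : ℝ) 1 → ω₁ + ω₂ = 1 → ∀ v ∈ M.Vh p t,
        MemLp (M.avgNormalDeriv ω₁ ω₂ t v) 2
          ((Measure.euclideanHausdorffMeasure (d - 1)).restrict (M.Γ t)) ∧
        k * surfaceIntegral (M.Γ t) (fun s => M.avgNormalDeriv ω₁ ω₂ t v s ^ 2) ≤
          C * ((∫ x in M.Ω1 t, ‖gradient v.val x‖ ^ 2) + (∫ x in M.Ω2 t, ‖gradient v.val x‖ ^ 2) +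
            ∫ x in M.ΩO t, ‖v.gradJump x‖ ^ 2) := by
  classical
  obtain ⟨Ci, hCi, Hi⟩ := exists_polyGrad_sq_le_integral_cell d p (κ := κ) hρ
  obtain ⟨Cs, hCs, Hs⟩ := exists_hausdorff_Γ_inter_closedBall_le hd σ hκ hρ
  -- The factor `3` collects the energy on `Ω2`: twice from covered background cells, once from
  -- cells of `TG`.
  refine ⟨3 * Ci * Cs, by positivity, fun M t k ht hk hcell ω₁ ω₂ hω₁ hω₂ hω v hv => ?_⟩
  obtain ⟨q₁, hp₁, hq₁⟩ := exists_pieces hv.1.2.1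
  obtain ⟨q₂, hp₂, hq₂⟩ := exists_pieces hv.2.1.2
  set μ := (Measure.euclideanHausdorffMeasure (d - 1) : Measure (E d)) with hμ
  have hfin : IsFiniteMeasure (μ.restrict (M.Γ t)) :=
    isFiniteMeasure_restrict.2 (M.hausdorff_Γ_lt_top hd ht).ne
  let A₁ := (M.finite_cutCells t).toFinset
  let A₂ := (M.mesh_TG t ht).1.toFinset
  have hA₁ : ∀ s ∈ A₁, s ∈ M.cutCells t := fun s hs => by simpa [A₁] using hs
  have hA₂ : ∀ s ∈ A₂, s ∈ cells (M.TG t) := fun s hs => by simpa [A₂] using hs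
  let α₁ : Finset (E d) → ℝ := fun s =>
    Ci * (k ^ d)⁻¹ * ∫ x in interior (hull s), ‖gradient v.ext1 x‖ ^ 2
  let α₂ : Finset (E d) → ℝ := fun s =>
    Ci * (k ^ d)⁻¹ * ∫ x in interior (hull s), ‖gradient v.ext2 x‖ ^ 2
  have hα₁ : ∀ s, 0 ≤ α₁ s := fun s =>
    mul_nonneg (by positivity) (integral_nonneg fun x => by positivity)
  have hα₂ : ∀ s, 0 ≤ α₂ s := fun s =>
    mul_nonneg (by positivity) (integral_nonneg fun x => by positivity)
  -- A majorant that avoids choosing cells: it sums the inverse-estimate bounds of all cells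
  -- containing the point, although one per side suffices.
  let g : E d → ℝ := fun x => ∑ s ∈ A₁, (hull s).indicator (fun _ => α₁ s) x +
    ∑ s ∈ A₂, (hull s).indicator (fun _ => α₂ s) x
  have hind : ∀ (s : Finset (E d)) (c : ℝ),
      Integrable ((hull s).indicator fun _ => c) (μ.restrict (M.Γ t)) := fun s c =>
    (integrable_const c).indicator (isClosed_hull s).measurableSet
  have hg : Integrable g (μ.restrict (M.Γ t)) :=
    (integrable_finsetSum _ fun s _ => hind s _).add (integrable_finsetSum _ fun s _ => hind s _)
  have hle : ∀ᵐ s ∂μ.restrict (M.Γ t), M.avgNormalDeriv ω₁ ω₂ t v s ^ 2 ≤ g s := by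
    refine M.ae_restrict_Γ_of_notMem_badSet hd ht fun s hs hbad => ?_
    obtain ⟨n, hn, K₁, hK₁, hsK₁, K₂, hK₂, hsK₂, h⟩ :=
      M.exists_eventually_jump_avg_eq hd ht hv hq₁ hq₂ hs hbad
    rw [(h.self_of_nhdsWithin hs).2]
    refine (weighted_sq_le hω₁ hω₂ hω).trans ?_
    have hcs : ∀ w : E d, inner ℝ n w ^ 2 ≤ ‖w‖ ^ 2 := by
      intro w
      refine sq_le_sq.2 ?_
      rw [abs_of_nonneg (norm_nonneg w)]
      simpa [hn] using abs_real_inner_le_norm n w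
    have hK₁A : K₁ ∈ A₁ := by
      simp only [A₁, Finite.mem_toFinset]
      exact ⟨hK₁, s, hsK₁, hs⟩
    have hK₂A : K₂ ∈ A₂ := by simpa [A₂] using hK₂
    refine add_le_add ?_ ?_
    · refine (hcs _).trans ((Hi k hk K₁ (hcell K₁ (Or.inl hK₁)) v.ext1 (q₁ K₁) (hp₁ K₁ hK₁)
        (hq₁ K₁ hK₁) s hsK₁).trans ?_)
      have := Finset.single_le_sum (f := fun K => (hull K).indicator (fun _ => α₁ K) s)
        (fun K _ => indicator_nonneg (fun _ _ => hα₁ K) s) hK₁A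
      simpa only [indicator_of_mem hsK₁] using this
    · refine (hcs _).trans ((Hi k hk K₂ (hcell K₂ (Or.inr hK₂)) v.ext2 (q₂ K₂) (hp₂ K₂ hK₂)
        (hq₂ K₂ hK₂) s hsK₂).trans ?_)
      have := Finset.single_le_sum (f := fun K => (hull K).indicator (fun _ => α₂ K) s)
        (fun K _ => indicator_nonneg (fun _ _ => hα₂ K) s) hK₂A
      simpa only [indicator_of_mem hsK₂] using this
  have hsm := M.aestronglyMeasurable_avgNormalDeriv hd ht hv ω₁ ω₂
  have hinteg : Integrable (fun s => M.avgNormalDeriv ω₁ ω₂ t v s ^ 2) (μ.restrict (M.Γ t)) := by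
    refine hg.mono' (hsm.pow 2) ?_
    filter_upwards [hle] with s hs
    rwa [Real.norm_of_nonneg (sq_nonneg _)]
  refine ⟨(memLp_two_iff_integrable_sq hsm).2 hinteg, ?_⟩
  have hbound : ∀ s ∈ M.allCells t, ∀ c, 0 ≤ c →
      ∫ x in M.Γ t, (hull s).indicator (fun _ => c) x ∂μ ≤ Cs * k ^ (d - 1) * c := by
    intro s hs c hc
    rw [integral_indicator_const _ (isClosed_hull s).measurableSet, smul_eq_mul]
    refine mul_le_mul_of_nonneg_right ?_ hc
    rw [measureReal_restrict_apply (isClosed_hull s).measurableSet]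
    obtain ⟨x, -, hx⟩ := (hcell s hs).exists_ball
    exact ENNReal.toReal_le_of_le_ofReal (by positivity)
      ((measure_mono (inter_subset_inter_left _ hx)).trans (Hs M t k ht hk hcell x))
  have h1 := M.sum_integral_ext1_le ht hv A₁ hA₁
  have h2 := M.sum_integral_ext2_le ht hv A₂ hA₂
  set I₁ := ∫ x in M.Ω1 t, ‖gradient v.val x‖ ^ 2
  set I₂ := ∫ x in M.Ω2 t, ‖gradient v.val x‖ ^ 2
  set Iov := ∫ x in M.ΩO t, ‖v.gradJump x‖ ^ 2
  have hI₁ : 0 ≤ I₁ := integral_nonneg fun x => by positivity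
  have hIov : 0 ≤ Iov := integral_nonneg fun x => by positivity
  have hmain : surfaceIntegral (M.Γ t) (fun s => M.avgNormalDeriv ω₁ ω₂ t v s ^ 2) ≤
      Cs * k ^ (d - 1) * (Ci * (k ^ d)⁻¹) * (3 * (I₁ + I₂ + Iov)) := by
    calc surfaceIntegral (M.Γ t) (fun s => M.avgNormalDeriv ω₁ ω₂ t v s ^ 2)
        ≤ ∫ x in M.Γ t, g x ∂μ := integral_mono_ae hinteg hg hle
      _ = (∑ s ∈ A₁, ∫ x in M.Γ t, (hull s).indicator (fun _ => α₁ s) x ∂μ) +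
          ∑ s ∈ A₂, ∫ x in M.Γ t, (hull s).indicator (fun _ => α₂ s) x ∂μ := by
          simp only [g]
          rw [integral_add (integrable_finsetSum _ fun s _ => hind s _)
            (integrable_finsetSum _ fun s _ => hind s _),
            integral_finsetSum _ fun s _ => hind s _, integral_finsetSum _ fun s _ => hind s _]
      _ ≤ (∑ s ∈ A₁, Cs * k ^ (d - 1) * α₁ s) + ∑ s ∈ A₂, Cs * k ^ (d - 1) * α₂ s := by
          refine add_le_add (Finset.sum_le_sum fun s hs => ?_) (Finset.sum_le_sum fun s hs => ?_)
          · exact hbound s (Or.inl (hA₁ s hs).1) _ (hα₁ s)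
          · exact hbound s (Or.inr (hA₂ s hs)) _ (hα₂ s)
      _ = Cs * k ^ (d - 1) * (Ci * (k ^ d)⁻¹) *
          ((∑ s ∈ A₁, ∫ x in interior (hull s), ‖gradient v.ext1 x‖ ^ 2) +
            ∑ s ∈ A₂, ∫ x in interior (hull s), ‖gradient v.ext2 x‖ ^ 2) := by
          simp only [α₁, α₂, ← Finset.mul_sum]
          ring
      _ ≤ _ := by
          refine mul_le_mul_of_nonneg_left ?_ (by positivity)
          linarith
  -- Measure `kᵈ⁻¹`, pointwise bound `k⁻ᵈ` and weight `k` balance, so the constant is independent of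
  -- the scale.
  have hkd : k * (k ^ (d - 1) * (k ^ d)⁻¹) = 1 := by
    rw [← mul_assoc, ← pow_succ', Nat.sub_add_cancel hd, mul_inv_cancel₀ (by positivity)]
  calc k * surfaceIntegral (M.Γ t) (fun s => M.avgNormalDeriv ω₁ ω₂ t v s ^ 2)
      ≤ k * (Cs * k ^ (d - 1) * (Ci * (k ^ d)⁻¹) * (3 * (I₁ + I₂ + Iov))) := by gcongr
    _ = (k * (k ^ (d - 1) * (k ^ d)⁻¹)) * (3 * Ci * Cs * (I₁ + I₂ + Iov)) := by ring
    _ = 3 * Ci * Cs * (I₁ + I₂ + Iov) := by rw [hkd, one_mul]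

end OverlappingMeshes

/-! ### Mesh-dependent norms, the penalty term and Young's inequality. -/

namespace OverlappingMeshes

variable {d : ℕ} {σ κ : ℝ} (M : OverlappingMeshes d σ κ) {ρ k : ℝ} {t : ℝ}

/-- Replace `hK` by `κ k`; closed cells may share parts of `Γ`, and the bounded overlap accounts for
the repeated counting. -/
theorem normNegHalfSq_le (hd : 1 ≤ d) (hκ : 0 < κ) (hρ : 0 < ρ) (hk : 0 < k)
    (hcell : ∀ s ∈ M.allCells t, IsCellAtScale κ ρ k s) {f : E d → ℝ}
    (hf : MemLp f 2 ((Measure.euclideanHausdorffMeasure (d - 1)).restrict (M.Γ t))) :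
    M.normNegHalfSq t f ≤
      κ * ((κ + ρ) / ρ) ^ d * (k * surfaceIntegral (M.Γ t) (fun s => f s ^ 2)) := by
  rw [normNegHalfSq, finsum_mem_eq_finite_toFinset_sum _ (M.finite_cutCells t)]
  calc ∑ s ∈ (M.finite_cutCells t).toFinset, hK s * surfaceIntegral (hull s ∩ M.Γ t) (fun x => f x ^ 2)
      ≤ ∑ s ∈ (M.finite_cutCells t).toFinset,
        κ * k * surfaceIntegral (hull s ∩ M.Γ t) (fun x => f x ^ 2) := by
        refine Finset.sum_le_sum fun s hs => mul_le_mul_of_nonneg_right ?_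
          (integral_nonneg fun x => sq_nonneg _)
        rw [Finite.mem_toFinset] at hs
        exact (hcell s (Or.inl hs.1)).hK_le
    _ ≤ κ * k * (((κ + ρ) / ρ) ^ d * surfaceIntegral (M.Γ t) (fun s => f s ^ 2)) := by
        rw [← Finset.mul_sum]
        exact mul_le_mul_of_nonneg_left (M.sum_surfaceIntegral_cutCells_le hd hκ hρ hk hcell
          (fun x => sq_nonneg _) hf.integrable_sq) (by positivity)
    _ = _ := by ring

theorem normHalfSq_le (hd : 1 ≤ d) (hκ : 0 < κ) (hρ : 0 < ρ) (hk : 0 < k)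
    (hcell : ∀ s ∈ M.allCells t, IsCellAtScale κ ρ k s) {f : E d → ℝ}
    (hf : MemLp f 2 ((Measure.euclideanHausdorffMeasure (d - 1)).restrict (M.Γ t))) :
    M.normHalfSq t f ≤
      κ * ((κ + ρ) / ρ) ^ d * (k⁻¹ * surfaceIntegral (M.Γ t) (fun s => f s ^ 2)) := by
  rw [normHalfSq, finsum_mem_eq_finite_toFinset_sum _ (M.finite_cutCells t)]
  calc ∑ s ∈ (M.finite_cutCells t).toFinset,
        (hK s)⁻¹ * surfaceIntegral (hull s ∩ M.Γ t) (fun x => f x ^ 2)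
      ≤ ∑ s ∈ (M.finite_cutCells t).toFinset,
        κ * k⁻¹ * surfaceIntegral (hull s ∩ M.Γ t) (fun x => f x ^ 2) := by
        refine Finset.sum_le_sum fun s hs => mul_le_mul_of_nonneg_right ?_
          (integral_nonneg fun x => sq_nonneg _)
        rw [Finite.mem_toFinset] at hs
        have h := (hcell s (Or.inl hs.1)).le_hK
        have hpos : 0 < hK s := pos_of_mul_pos_right (hk.trans_le h) hκ.le
        rw [inv_le_iff_one_le_mul₀ hpos, mul_right_comm, ← div_eq_mul_inv, one_le_div hk]
        exact h
    _ ≤ κ * k⁻¹ * (((κ + ρ) / ρ) ^ d * surfaceIntegral (M.Γ t) (fun s => f s ^ 2)) := by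
        rw [← Finset.mul_sum]
        exact mul_le_mul_of_nonneg_left (M.sum_surfaceIntegral_cutCells_le hd hκ hρ hk hcell
          (fun x => sq_nonneg _) hf.integrable_sq) (by positivity)
    _ = _ := by ring

/-- The lower bound of the penalty term. -/
theorem le_surfaceIntegral_penalty (ht : t ∈ Icc 0 M.T) (hκ : 0 < κ) (hk : 0 < k)
    (hcell : ∀ s ∈ M.allCells t, IsCellAtScale κ ρ k s) {f : E d → ℝ}
    (hf : MemLp f 2 ((Measure.euclideanHausdorffMeasure (d - 1)).restrict (M.Γ t))) {γ : ℝ}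
    (hγ : 0 ≤ γ) :
    γ * (κ * k)⁻¹ * surfaceIntegral (M.Γ t) (fun s => f s ^ 2) ≤
      surfaceIntegral (M.Γ t) (fun s => γ * (M.meshSize s)⁻¹ * f s * f s) := by
  have hms : ∀ s ∈ M.Γ t, 0 < M.meshSize s := fun s hs =>
    pos_of_mul_pos_right (hk.trans_le (M.meshSize_bounds ht hκ hcell hs).2) hκ.le
  rw [surfaceIntegral, surfaceIntegral, ← integral_const_mul]
  refine integral_mono_ae (hf.integrable_sq.const_mul _) ?_ ?_
  -- Integrability of the penalty is essential, as its integral would otherwise be `0` by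
  -- convention; it follows from the lower bound on the mesh size.
  · have h1 : Integrable (fun s => (γ * (M.meshSize s)⁻¹) * f s ^ 2)
        ((Measure.euclideanHausdorffMeasure (d - 1)).restrict (M.Γ t)) := by
      refine hf.integrable_sq.bdd_mul (c := γ * (κ * k⁻¹))
        (measurable_const.mul M.measurable_meshSize.inv).aestronglyMeasurable ?_
      refine (ae_restrict_iff' (M.isClosed_Γ t).measurableSet).2 (Eventually.of_forall fun s hs => ?_)
      have h2 := hms s hs
      rw [Real.norm_of_nonneg (by positivity)]
      refine mul_le_mul_of_nonneg_left ?_ hγ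
      rw [inv_le_iff_one_le_mul₀ h2, mul_right_comm, ← div_eq_mul_inv, one_le_div hk]
      exact (M.meshSize_bounds ht hκ hcell hs).2
    refine h1.congr (Eventually.of_forall fun s => ?_)
    simp only
    ring
  · refine (ae_restrict_iff' (M.isClosed_Γ t).measurableSet).2 (Eventually.of_forall fun s hs => ?_)
    have h2 := hms s hs
    have h3 := (M.meshSize_bounds ht hκ hcell hs).1
    calc γ * (κ * k)⁻¹ * f s ^ 2 ≤ γ * (M.meshSize s)⁻¹ * f s ^ 2 := by gcongr
      _ = γ * (M.meshSize s)⁻¹ * f s * f s := by ring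

/-- Young's inequality: expand `δ⁻¹ (δ f - g)² ≥ 0` and integrate. -/
theorem two_mul_surfaceIntegral_mul_le {A : Set (E d)} {f g : E d → ℝ}
    (hf : MemLp f 2 ((Measure.euclideanHausdorffMeasure (d - 1)).restrict A))
    (hg : MemLp g 2 ((Measure.euclideanHausdorffMeasure (d - 1)).restrict A)) {δ : ℝ}
    (hδ : 0 < δ) :
    2 * surfaceIntegral A (fun s => f s * g s) ≤
      δ * surfaceIntegral A (fun s => f s ^ 2) + δ⁻¹ * surfaceIntegral A (fun s => g s ^ 2) := by
  simp only [surfaceIntegral]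
  rw [← integral_const_mul, ← integral_const_mul, ← integral_const_mul,
    ← integral_add (hf.integrable_sq.const_mul _) (hg.integrable_sq.const_mul _)]
  refine integral_mono ((hf.integrable_mul hg).const_mul 2)
    ((hf.integrable_sq.const_mul _).add (hg.integrable_sq.const_mul _)) fun s => ?_
  have h : 0 ≤ δ⁻¹ * (δ * f s - g s) ^ 2 := by positivity
  have h2 : δ⁻¹ * (δ * f s - g s) ^ 2 = δ * f s ^ 2 + δ⁻¹ * g s ^ 2 - 2 * (f s * g s) := by
    field_simp
    ring
  simp only
  linarith

end OverlappingMeshes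

end CutFEM

end

/-! ### Coercivity. -/

theorem lemma4p1 (d : ℕ) (hd₁ : 1 ≤ d) (hd₃ : d ≤ 3) (p : ℕ) (σ κ : ℝ) :
    ∃ γ₀ c : ℝ, 0 < c ∧
      ∀ (M : CutFEM.OverlappingMeshes d σ κ) (ω₁ ω₂ : ℝ),
        ω₁ ∈ Set.Icc (0 : ℝ) 1 → ω₂ ∈ Set.Icc (0 : ℝ) 1 → ω₁ + ω₂ = 1 →
        ∀ γ : ℝ, γ₀ ≤ γ → ∀ t ∈ Set.Icc (0 : ℝ) M.T, ∀ v ∈ M.Vh p t,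
          c * M.energySq ω₁ ω₂ t v ≤ M.form γ ω₁ ω₂ t v v := by
  -- Any instance of the meshes forces both constants to be positive; otherwise the claim is
  -- vacuous.
  by_cases hpos : 0 < κ ∧ 0 < σ
  swap
  · refine ⟨0, 1, one_pos, fun M ω₁ ω₂ _ _ _ γ _ t ht => ?_⟩
    obtain ⟨hκ, hσ, -⟩ := M.exists_scale ht
    exact absurd ⟨hκ, hσ⟩ hpos
  obtain ⟨hκ, hσ⟩ := hpos
  have hρ : 0 < (κ * σ)⁻¹ := by positivity
  obtain ⟨C, hC, H⟩ :=
    CutFEM.OverlappingMeshes.exists_integral_avgNormalDeriv_sq_le hd₁ p σ hκ hρ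
  set b : ℝ := κ * ((κ + (κ * σ)⁻¹) / (κ * σ)⁻¹) ^ d with hb
  have hb0 : 0 < b := by positivity
  -- The penalty is at least `γ J / (κ k)`, so this `γ₀` yields `(2 C + 1) J / k`: `2 C` absorbs the
  -- cross term and `1` remains. The value of `c` compares `E / 2 + J / k` with the norm bound `(1 +
  -- b C) E + b J / k`.
  refine ⟨κ * (2 * C + 1), (2 * (1 + b * C + b))⁻¹, by positivity,
    fun M ω₁ ω₂ hω₁ hω₂ hω γ hγ t ht v hv => ?_⟩
  obtain ⟨-, -, k, hk, hcell⟩ := M.exists_scale ht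
  obtain ⟨havg, htrace⟩ := H M t k ht hk hcell ω₁ ω₂ hω₁ hω₂ hω v hv
  have hjump := M.memLp_jump hd₁ ht hv
  have hN := M.normNegHalfSq_le hd₁ hκ hρ hk hcell havg
  have hJ := M.normHalfSq_le hd₁ hκ hρ hk hcell hjump
  have hγ0 : 0 ≤ γ := le_trans (by positivity) hγ
  have hS := M.le_surfaceIntegral_penalty ht hκ hk hcell hjump hγ0
  -- The weight `k / (2 C)` makes the trace inequality cost exactly half of `E`.
  have hY := CutFEM.OverlappingMeshes.two_mul_surfaceIntegral_mul_le havg hjump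
    (show 0 < (2 * C)⁻¹ * k by positivity)
  rw [CutFEM.OverlappingMeshes.form, CutFEM.OverlappingMeshes.energySq]
  simp only [real_inner_self_eq_norm_sq]
  rw [← hb] at hN hJ
  have hJ0 : 0 ≤ CutFEM.surfaceIntegral (M.Γ t) (fun s => M.jump t v s ^ 2) :=
    MeasureTheory.integral_nonneg fun x => sq_nonneg _
  have hI₁ : 0 ≤ ∫ x in M.Ω1 t, ‖gradient v.val x‖ ^ 2 :=
    MeasureTheory.integral_nonneg fun x => by positivity
  have hI₂ : 0 ≤ ∫ x in M.Ω2 t, ‖gradient v.val x‖ ^ 2 :=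
    MeasureTheory.integral_nonneg fun x => by positivity
  have hIov : 0 ≤ ∫ x in M.ΩO t, ‖v.gradJump x‖ ^ 2 :=
    MeasureTheory.integral_nonneg fun x => by positivity
  generalize CutFEM.surfaceIntegral (M.Γ t) (fun s => M.jump t v s ^ 2) = J at *
  generalize CutFEM.surfaceIntegral (M.Γ t) (fun s => M.avgNormalDeriv ω₁ ω₂ t v s ^ 2) = N at *
  generalize CutFEM.surfaceIntegral (M.Γ t)
    (fun s => M.avgNormalDeriv ω₁ ω₂ t v s * M.jump t v s) = P at *
  generalize CutFEM.surfaceIntegral (M.Γ t)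
    (fun s => γ * (M.meshSize s)⁻¹ * M.jump t v s * M.jump t v s) = S at *
  generalize M.normNegHalfSq t (M.avgNormalDeriv ω₁ ω₂ t v) = N' at *
  generalize M.normHalfSq t (M.jump t v) = J' at *
  generalize (∫ x in M.Ω1 t, ‖gradient v.val x‖ ^ 2) = I₁ at *
  generalize (∫ x in M.Ω2 t, ‖gradient v.val x‖ ^ 2) = I₂ at *
  generalize (∫ x in M.ΩO t, ‖v.gradJump x‖ ^ 2) = Iov at *
  have hkJ : 0 ≤ k⁻¹ * J := by positivity
  have hS' : (2 * C + 1) * (k⁻¹ * J) ≤ S := by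
    refine le_trans ?_ hS
    calc (2 * C + 1) * (k⁻¹ * J) = κ * (2 * C + 1) * (κ * k)⁻¹ * J := by field_simp
      _ ≤ γ * (κ * k)⁻¹ * J := by gcongr
  have hY' : 2 * P ≤ (I₁ + I₂ + Iov) / 2 + 2 * C * (k⁻¹ * J) := by
    refine hY.trans (add_le_add ?_ (le_of_eq ?_))
    · calc (2 * C)⁻¹ * k * N = (2 * C)⁻¹ * (k * N) := by ring
        _ ≤ (2 * C)⁻¹ * (C * (I₁ + I₂ + Iov)) := by gcongr
        _ = (I₁ + I₂ + Iov) / 2 := by field_simp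
    · field_simp
  have hN' : N' ≤ b * C * (I₁ + I₂ + Iov) := by
    rw [mul_assoc]
    exact hN.trans (mul_le_mul_of_nonneg_left htrace hb0.le)
  have hlow : (I₁ + I₂ + Iov) / 2 + k⁻¹ * J ≤ I₁ + I₂ - P - P + S + Iov := by linarith
  refine le_trans ?_ hlow
  rw [inv_mul_le_iff₀ (by positivity)]
  have hE : 0 ≤ I₁ + I₂ + Iov := by positivity
  have hbE : 0 ≤ b * (I₁ + I₂ + Iov) := by positivity
  have hbC : 0 ≤ b * C * (k⁻¹ * J) := by positivity
  have hbJ : 0 ≤ b * (k⁻¹ * J) := by positivity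
  calc I₁ + I₂ + N' + J' + Iov ≤ (I₁ + I₂ + Iov) + b * C * (I₁ + I₂ + Iov) + b * (k⁻¹ * J) := by
        linarith
    _ ≤ 2 * (1 + b * C + b) * ((I₁ + I₂ + Iov) / 2 + k⁻¹ * J) := by linarith
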